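/- Let $k$ be a field and $\Lambda$ a finite-dimensional $k$-algebra. Write $\operatorname{mod}\Lambda$ for the category of finitely generated left $\Lambda$-modules and $D^b(\operatorname{mod}\Lambda)$ for its bounded derived category. The Yoneda category of $\Lambda$ is the full subcategory $$\mathcal U(\Lambda)=\operatorname{add}\{A[i] \mid A\in\operatorname{mod}\Lambda,\ i\in\mathbb Z\}\subseteq D^b(\operatorname{mod}\Lambda)$$ of direct summands of finite direct sums of shifts of modules. For a preadditive category $\mathcal C$, a $\mathcal C$-module is an additive functor $\mathcal C^{op}\to\mathrm{Ab}$; it is finitely presented if it is the cokernel of a map $\mathcal C(-,B)\to\mathcal C(-,A)$, and $\operatorname{mod}\mathcal C$ denotes the category of finitely presented $\mathcal C$-modules. $\mathcal C$ is coherent if it has weak kernels and weak cokernels, and $\mathcal C$ is self-injective if it is coherent, every representable $\mathcal C$-module is injective in $\operatorname{mod}\mathcal C$, and every representable $\mathcal C^{op}$-module is injective in $\operatorname{mod}\mathcal C^{op}$. $\Lambda$ is hereditary if every left ideal of $\Lambda$ is projective. Then $\mathcal U(\Lambda)$ is self-injective if and only if $\Lambda$ is hereditary. (For the "only if" part it suffices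 that the representable $\mathcal U(\Lambda)$- and $\mathcal U(\Lambda)^{op}$-modules are injective in $\operatorname{mod}\mathcal U(\Lambda)$ and $\operatorname{mod}\mathcal U(\Lambda)^{op}$; coherence of $\mathcal U(\Lambda)$ need not be assumed.) In particular, suppose $\Lambda$ is hereditary and representation-finite (there are only finitely many finitely generated indecomposable modules up to isomorphism), and let $M\in\operatorname{mod}\Lambda$ be an additive generator, i.e. every finitely generated $\Lambda$-module is a direct summand of a finite direct sum of copies of $M$. Then the Yoneda algebra $$\Gamma=\bigoplus_{i\ge 0}\operatorname{Ext}^i_\Lambda(M,M),$$ with the Yoneda product, is self-injective: as a $\mathbb Z$-graded ring it is left and right graded coherent (the categories of finitely presented graded left, respectively right, modules with degree-preserving maps are abelian) and it is injective in the categories of finitely presented graded left and right $\Gamma$-modules; also, as an ungraded ring, $\Gamma$ is injective as a left and as a right module over itself. -/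

import Mathlib

open CategoryTheory Limits Opposite
open scoped DirectSum

universe u v w w'

/-! ### Modules over a preadditive category, coherence and self-injectivity -/

section FunctorCategories

variable (C : Type u) [Category.{v} C] [Preadditive C]

/-- A module over a preadditive category `C` is an additive functor `F` from `Cᵒᵖ` to abelian
groups.  It is finitely presented if there is an exact sequence `C(-, B) ⟶ C(-, A) ⟶ F ⟶ 0`;
exactness means exactness at every object. -/
def IsFinitelyPresentedModule : ObjectProperty (Cᵒᵖ ⥤ AddCommGrpCat.{v}) := fun F =>
  F.Additive ∧
    ∃ (A B : C) (g : B ⟶ A) (p : preadditiveYoneda.obj A ⟶ F),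
      ∀ X : Cᵒᵖ, Function.Exact ((preadditiveYoneda.map g).app X) (p.app X) ∧
        Function.Surjective (p.app X)

/-- The category `mod C` of finitely presented `C`-modules. -/
abbrev ModCat := (IsFinitelyPresentedModule C).FullSubcategory

variable {C}

theorem isFinitelyPresentedModule_preadditiveYoneda (X : C) :
    IsFinitelyPresentedModule C (preadditiveYoneda.obj X) := by
  refine ⟨inferInstance, X, X, 0, 𝟙 _, fun Y => ⟨fun y => ?_, fun y => ⟨y, rfl⟩⟩⟩
  constructor
  · intro h
    exact ⟨0, by rw [map_zero]; exact h.symm⟩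
  · rintro ⟨z, rfl⟩
    exact comp_zero (f := (z : Y.unop ⟶ X))

/-- The representable module `C(-, X)`, as an object of `mod C`. -/
abbrev representableModule (X : C) : ModCat C :=
  ⟨preadditiveYoneda.obj X, isFinitelyPresentedModule_preadditiveYoneda X⟩

variable (C)

/-- `C` is coherent if it has weak kernels and weak cokernels (a weak cokernel in `C` is a weak
kernel in `Cᵒᵖ`). -/
def IsCoherentCategory : Prop := HasWeakKernels C ∧ HasWeakKernels Cᵒᵖ

/-- All representable `C`-modules are injective objects of `mod C`, and all representable
`Cᵒᵖ`-modules are injective objects of `mod Cᵒᵖ`. -/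
def RepresentablesAreInjective : Prop :=
  (∀ X : C, Injective (representableModule X)) ∧
    ∀ X : Cᵒᵖ, Injective (representableModule X)

/-- A self-injective category: a coherent category whose representable modules, on both sides,
are injective in the respective category of finitely presented modules. -/
structure IsSelfInjectiveCategory : Prop where
  coherent : IsCoherentCategory C
  injective : RepresentablesAreInjective C

end FunctorCategories

/-! ### The Yoneda category of an algebra -/

/-- `add P`: the direct summands of finite direct sums of objects satisfying `P`. -/
def addClosure {C : Type u} [Category.{v} C] [HasZeroMorphisms C] (P : ObjectProperty C) :
    ObjectProperty C := fun X =>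
  ∃ (n : ℕ) (F : Fin n → C) (b : Bicone F),
    (∀ j, P (F j)) ∧ Nonempty b.IsBilimit ∧ Nonempty (Retract X b.pt)

section Yoneda

variable (R : Type v) [Ring R] [IsNoetherianRing R]
  [HasDerivedCategory.{w} (FGModuleCat.{v} R)]

/-- The objects `A[i]` of `Dᵇ(mod R)`, for `A` a finitely generated left `R`-module (viewed as a
complex concentrated in degree zero) and `i : ℤ`. -/
def isShiftOfModule : ObjectProperty (DerivedCategory.Bounded (FGModuleCat.{v} R)) := fun X =>
  ∃ (A : FGModuleCat.{v} R) (i : ℤ),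
    Nonempty (X.obj ≅
      (shiftFunctor (DerivedCategory (FGModuleCat.{v} R)) i).obj
        ((DerivedCategory.singleFunctor (FGModuleCat.{v} R) 0).obj A))

/-- The Yoneda category `U(R) = add { A[i] | A ∈ mod R, i ∈ ℤ }`, a full subcategory of
`Dᵇ(mod R)`. -/
abbrev YonedaCategory := (addClosure (isShiftOfModule R)).FullSubcategory

end Yoneda

/-! ### Hereditary and representation-finite algebras -/

/-- Every left ideal is projective. (For a ring that is Noetherian on both sides, this is
equivalent to every right ideal being projective.) -/
def IsHereditaryRing (R : Type v) [Ring R] : Prop :=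
  ∀ I : Ideal R, Module.Projective R I

/-- There are only finitely many finitely generated indecomposable modules up to isomorphism. -/
def IsRepresentationFinite (R : Type v) [Ring R] [IsNoetherianRing R] : Prop :=
  ∃ (n : ℕ) (S : Fin n → FGModuleCat.{v} R),
    ∀ X : FGModuleCat.{v} R, Indecomposable X → ∃ j, Nonempty (X ≅ S j)

/-- `M` is an additive generator of `mod R`: `add M = mod R`. -/
def IsAdditiveGenerator {R : Type v} [Ring R] [IsNoetherianRing R] (M : FGModuleCat.{v} R) :
    Prop :=
  ∀ X : FGModuleCat.{v} R, addClosure (fun Y => Nonempty (Y ≅ M)) X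

/-! ### The Yoneda algebra of an object -/

section YonedaAlgebra

variable {C : Type u} [Category.{v} C] [Abelian C] [HasExt.{w} C] (M : C)

theorem gradedMonoid_mk_ext_comp {a b c d : ℕ} (x : Abelian.Ext M M a) (y : Abelian.Ext M M b)
    (hc : a + b = c) (hd : a + b = d) :
    GradedMonoid.mk (A := fun n : ℕ => Abelian.Ext.{w} M M n) c (x.comp y hc) =
      GradedMonoid.mk d (x.comp y hd) := by
  subst hc
  subst hd
  rfl

noncomputable instance yonedaGMul : GradedMonoid.GMul (fun n : ℕ => Abelian.Ext.{w} M M n) where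
  mul x y := x.comp y rfl

noncomputable instance yonedaGOne : GradedMonoid.GOne (fun n : ℕ => Abelian.Ext.{w} M M n) where
  one := Abelian.Ext.mk₀ (𝟙 M)

/-- The Yoneda product makes `Ext^*(M, M)` into a graded ring. -/
noncomputable instance yonedaGRing : DirectSum.GRing (fun n : ℕ => Abelian.Ext.{w} M M n) where
  one_mul := by
    rintro ⟨n, x⟩
    exact (gradedMonoid_mk_ext_comp M (Abelian.Ext.mk₀ (𝟙 M)) x rfl (zero_add n)).trans
      (congrArg (GradedMonoid.mk n) (Abelian.Ext.mk₀_id_comp x))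
  mul_one := by
    rintro ⟨n, x⟩
    exact (gradedMonoid_mk_ext_comp M x (Abelian.Ext.mk₀ (𝟙 M)) rfl (add_zero n)).trans
      (congrArg (GradedMonoid.mk n) (Abelian.Ext.comp_mk₀_id x))
  mul_assoc := by
    rintro ⟨a, x⟩ ⟨b, y⟩ ⟨c, z⟩
    refine (gradedMonoid_mk_ext_comp M (x.comp y rfl) z rfl (add_assoc a b c)).trans ?_
    exact congrArg (GradedMonoid.mk (A := fun n : ℕ => Abelian.Ext.{w} M M n) (a + (b + c)))
      (Abelian.Ext.comp_assoc x y z rfl rfl (add_assoc a b c))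
  mul_zero x := Abelian.Ext.comp_zero x _ _ _ rfl
  zero_mul y := Abelian.Ext.zero_comp _ _ y _ rfl
  mul_add x y z := Abelian.Ext.comp_add x y z rfl
  add_mul x y z := Abelian.Ext.add_comp x y z rfl
  natCast n := n • Abelian.Ext.mk₀ (𝟙 M)
  natCast_zero := zero_nsmul _
  natCast_succ n := succ_nsmul _ n
  intCast n := n • Abelian.Ext.mk₀ (𝟙 M)
  intCast_ofNat n := natCast_zsmul _ n
  intCast_negSucc_ofNat n := negSucc_zsmul _ n

/-- The Yoneda algebra `⨁ i ≥ 0, Ext^i(M, M)`, a ring under the Yoneda product. -/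
abbrev YonedaAlgebra := ⨁ n : ℕ, Abelian.Ext.{w} M M n

/-- The `ℤ`-grading of the Yoneda algebra: the degree `i` part is `Ext^i(M, M)`, which is zero
for `i < 0`. -/
def yonedaGrading (i : ℤ) : AddSubgroup (YonedaAlgebra.{u, v, w} M) where
  carrier := { x | ∀ n : ℕ, (n : ℤ) ≠ i → x n = 0 }
  zero_mem' _ _ := rfl
  add_mem' {x y} hx hy n hn := by
    rw [DirectSum.add_apply, hx n hn, hy n hn, add_zero]
  neg_mem' {x} hx n hn := by
    have h : (-x) n = -(x n) := DFinsupp.neg_apply x n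
    rw [h, hx n hn, neg_zero]

end YonedaAlgebra

/-! ### Self-injectivity of graded rings -/

section Graded

variable {R : Type w} [Ring R] (𝒜 : ℤ → AddSubgroup R)

/-- `𝒩` is a `ℤ`-grading of the left module `N` over the ring `R` graded by `𝒜`. -/
structure IsGradedModule {N : Type w'} [AddCommGroup N] [Module R N] (𝒩 : ℤ → AddSubgroup N) :
    Prop where
  isInternal : DirectSum.IsInternal 𝒩
  smul_mem : ∀ (i j : ℤ) (a : R) (x : N), a ∈ 𝒜 i → x ∈ 𝒩 j → a • x ∈ 𝒩 (i + j)

/-- A linear map preserving degrees. -/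
def IsGradedHom {N : Type w} {L : Type w'} [AddCommGroup N] [Module R N] [AddCommGroup L]
    [Module R L] (𝒩 : ℤ → AddSubgroup N) (ℒ : ℤ → AddSubgroup L) (f : N →ₗ[R] L) : Prop :=
  ∀ (i : ℤ) (x : N), x ∈ 𝒩 i → f x ∈ ℒ i

/-- Left graded coherence: the category `mod^ℤ R` of finitely presented graded left modules and
degree-preserving maps is abelian, that is, it is closed under kernels. -/
def IsLeftGradedCoherent : Prop :=
  ∀ (N L : Type w) [AddCommGroup N] [Module R N] [AddCommGroup L] [Module R L]
    (𝒩 : ℤ → AddSubgroup N) (ℒ : ℤ → AddSubgroup L) (f : N →ₗ[R] L),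
    IsGradedModule 𝒜 𝒩 → IsGradedModule 𝒜 ℒ →
    Module.FinitePresentation R N → Module.FinitePresentation R L →
    IsGradedHom 𝒩 ℒ f → Module.FinitePresentation R (LinearMap.ker f)

/-- The graded left module `R` is an injective object of `mod^ℤ R`. -/
def IsLeftGradedInjective : Prop :=
  ∀ (N L : Type w) [AddCommGroup N] [Module R N] [AddCommGroup L] [Module R L]
    (𝒩 : ℤ → AddSubgroup N) (ℒ : ℤ → AddSubgroup L) (i : N →ₗ[R] L) (f : N →ₗ[R] R),
    IsGradedModule 𝒜 𝒩 → IsGradedModule 𝒜 ℒ →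
    Module.FinitePresentation R N → Module.FinitePresentation R L →
    IsGradedHom 𝒩 ℒ i → Function.Injective i → IsGradedHom 𝒩 𝒜 f →
    ∃ g : L →ₗ[R] R, IsGradedHom ℒ 𝒜 g ∧ g ∘ₗ i = f

/-- The grading of the opposite ring. Right `R`-modules are left `Rᵐᵒᵖ`-modules. -/
def opGrading (i : ℤ) : AddSubgroup Rᵐᵒᵖ :=
  (𝒜 i).map (MulOpposite.opAddEquiv : R ≃+ Rᵐᵒᵖ).toAddMonoidHom

/-- A graded ring is self-injective if it is graded coherent and it is injective as a graded left
module and as a graded right module, in the categories of finitely presented graded modules. -/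
structure IsGradedSelfInjective : Prop where
  left_coherent : IsLeftGradedCoherent 𝒜
  right_coherent : IsLeftGradedCoherent (opGrading 𝒜)
  left_injective : IsLeftGradedInjective 𝒜
  right_injective : IsLeftGradedInjective (opGrading 𝒜)

end Graded

/-- A ring is self-injective if it is injective as a left module and as a right module over
itself. -/
def IsSelfInjectiveRing (R : Type w) [Ring R] : Prop :=
  Module.Injective R R ∧ Module.Injective Rᵐᵒᵖ Rᵐᵒᵖ

-- If `Λ` is hereditary, `Ext²` vanishes, so truncation triangles split and every bounded complex is
-- a summand of a finite sum of shifted modules (`factorsThroughSum_of_bounded`): the Yoneda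
-- category is all of `Dᵇ(mod Λ)`. A triangulated category is self-injective because each of its
-- morphisms is a weak cokernel, and the same holds in its opposite (`exists_isWeakCokernelOf`);
-- extending a map along a monomorphism of finitely presented modules amounts to one factorization
-- through a weak cokernel (`injective_representableModule`).
--
-- Conversely, let `ι : I ⟶ Λ` be the inclusion of a left ideal and `e : Λⁿ ⟶ I` an epimorphism. As
-- `Λ` is projective, `Ext^i(Λ, -) = 0` for `i > 0`, and `Λ ⟶ Λ/I` remains a weak cokernel of `e ≫
-- ι` in the Yoneda category. Injectivity of the representables over the opposite category then
-- makes `ι`, which dies in `Λ/I`, factor through `e ≫ ι`. So `e` splits and `I` is projective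
-- (`isHereditaryRing_of_representablesAreInjective`).
--
-- For the Yoneda algebra `Γ` of an additive generator `M`, every object of `Dᵇ(mod Λ)` is a summand
-- of a sum of shifts of `M`. A triangle on the coefficients of a linear system with homogeneous
-- coefficients therefore shows that the system is solvable once the evident relations hold
-- (`exists_comp_eq`, `exists_comp_eq'`). Now `Γ` is finite-dimensional and lives in degrees 0 and
-- 1, and its degree 1 part lies in the radical; hence its maximal one-sided ideals are generated by
-- homogeneous elements. Over an Artinian ring Baer's criterion needs only maximal ideals
-- (`Module.Baer.of_isMaximal`), so `Γ` is self-injective. Graded injectivity follows by taking the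
-- degree-preserving part of an ungraded extension, and graded coherence from Noetherianity.

universe t

/-! ### Self-injectivity of Artinian and graded rings -/

section Rings

/-- Over a left Artinian ring, injectivity can be tested on the inclusions of maximal left
ideals. -/
theorem Module.Baer.of_isMaximal {R : Type*} [Ring R] [IsArtinianRing R] [IsNoetherianRing R]
    (h : ∀ m : Ideal R, m.IsMaximal → ∀ f : m →ₗ[R] R, ∃ y : R, ∀ a : m, f a = a * y) :
    Module.Baer R R := by
  suffices key : ∀ (J : Ideal R) (f : J →ₗ[R] R), ∃ y : R, ∀ a : J, f a = a * y by
    intro J f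
    obtain ⟨y, hy⟩ := key J f
    exact ⟨LinearMap.toSpanSingleton R R y, fun a ha => by
      rw [LinearMap.toSpanSingleton_apply, smul_eq_mul]; exact (hy ⟨a, ha⟩).symm⟩
  intro J
  induction J using WellFoundedGT.induction with
  | ind J ih =>
  intro f
  by_cases hJ : J = ⊤
  · subst hJ
    exact ⟨f ⟨1, trivial⟩, fun a => by
      rw [← smul_eq_mul, ← map_smul]; congr 1; ext; simp⟩
  obtain ⟨J', hJ'⟩ := exists_covBy_of_wellFoundedLT (a := J) (by simpa [isMax_iff_eq_top] using hJ)
  obtain ⟨x, hxJ', hxJ⟩ := SetLike.exists_of_lt hJ'.lt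
  have hsup : ∀ z ∈ J', z ∉ J → J ⊔ R ∙ z = J' := fun z hz hzJ =>
    (hJ'.eq_or_eq le_sup_left
      (sup_le hJ'.le ((Submodule.span_singleton_le_iff_mem _ _).2 hz))).resolve_left fun e =>
        hzJ (e.le ((le_sup_right : R ∙ z ≤ _) (Submodule.mem_span_singleton_self z)))
  -- `m` is the annihilator of the class of `x` in the simple module `J' / J`, hence maximal.
  let m : Ideal R := Submodule.comap (LinearMap.toSpanSingleton R R x) J
  have hm : ∀ c, c ∈ m ↔ c * x ∈ J := fun c => Iff.rfl
  have hmax : m.IsMaximal := by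
    refine Ideal.isMaximal_iff.2 ⟨by simpa [hm] using hxJ, fun K b hK hb hbK => ?_⟩
    have hx : x ∈ J ⊔ R ∙ (b * x) := by
      rw [hsup (b * x) (J'.mul_mem_left b hxJ') hb]; exact hxJ'
    obtain ⟨j, hj, t, ht, hjt⟩ := Submodule.mem_sup.1 hx
    obtain ⟨c, rfl⟩ := Submodule.mem_span_singleton.1 ht
    have h1 : (1 - c * b) ∈ K := hK ((hm _).2 (by
      have : (1 - c * b) * x = j := by
        rw [sub_mul, one_mul, mul_assoc, ← smul_eq_mul c, sub_eq_iff_eq_add]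
        exact hjt.symm
      rwa [this]))
    simpa using K.add_mem h1 (K.mul_mem_left c hbK)
  obtain ⟨y, hy⟩ := h m hmax
    { toFun := fun c => f ⟨c * x, c.2⟩
      map_add' := fun c d => by rw [← map_add]; congr 1; ext; simp [add_mul]
      map_smul' := fun r c => by
        rw [RingHom.id_apply, ← map_smul]; congr 1; ext; simp [mul_assoc] }
  have hy' : ∀ (c : R) (hc : c * x ∈ J), f ⟨c * x, hc⟩ = c * y := fun c hc => hy ⟨c, hc⟩
  let F : R →ₗ.[R] R := ⟨J, f⟩
  -- Sending `x` to `y` is well defined and agrees with `f` on `J ∩ R x`, so the two maps glue to an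
  -- extension of `f` to `J'`, to which the induction hypothesis applies.
  let G : R →ₗ.[R] R := LinearPMap.mkSpanSingleton' x y fun c hc => by
    have hc' : c * x = 0 := hc
    have := hy' c (by rw [hc']; exact J.zero_mem)
    rw [RingHom.id_apply, smul_eq_mul, ← this]
    exact (congrArg f (Subtype.ext hc' : _ = (0 : J))).trans (map_zero f)
  have hFG : ∀ (a : F.domain) (b : G.domain), (a : R) = b → F a = G b := by
    rintro ⟨a, ha⟩ ⟨b, hb⟩ (rfl : a = b)
    obtain ⟨c, rfl⟩ := Submodule.mem_span_singleton.1 hb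
    exact (hy' c ha).trans (LinearPMap.mkSpanSingleton'_apply x y _ c hb).symm
  obtain ⟨y', hy''⟩ := ih (F.sup G hFG).domain
    (by rw [LinearPMap.domain_sup]; exact (hsup x hxJ' hxJ).symm ▸ hJ'.lt) (F.sup G hFG).toFun
  refine ⟨y', fun a => ?_⟩
  exact ((LinearPMap.left_le_sup F G hFG).2 (x := a)
    (y := ⟨a, (LinearPMap.left_le_sup F G hFG).1 a.2⟩) rfl).trans (hy'' _)

/-- Suppose that every element of `R` is a sum of an element of `H` and an element of `H` lying in
the Jacobson radical. If linear equations with coefficients in `H` satisfying the evident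
compatibility condition have solutions, then `R` is left self-injective. -/
theorem Module.Injective.of_solvable {R : Type w} [Ring R] [IsArtinianRing R] [IsNoetherianRing R]
    (H : Set R) (hH : ∀ r : R, ∃ h ∈ H, ∃ n ∈ H, n ∈ Ring.jacobson R ∧ r = h + n)
    (hsolv : ∀ (ι : Type) [Fintype ι] (a b : ι → R), (∀ j, a j ∈ H) →
      (∀ z : ι → R, ∑ j, z j * a j = 0 → ∑ j, z j * b j = 0) → ∃ y, ∀ j, a j * y = b j) :
    Module.Injective R R := by
  refine Module.Baer.injective (Module.Baer.of_isMaximal fun m hm f => ?_)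
  choose h hh n hn hnJ hr using hH
  obtain ⟨k, s, hs⟩ := Submodule.fg_iff_exists_fin_generating_family.1
    (IsNoetherian.noetherian m)
  have hsm : ∀ i, s i ∈ m := fun i => hs.le (Submodule.subset_span ⟨i, rfl⟩)
  -- Maximality enters here: `m` contains the radical, hence both parts of each generator, and is
  -- thus generated by elements of `H`.
  have hnm : ∀ r, n r ∈ m := fun r => Ring.jacobson_le_of_isMaximal m (hnJ r)
  have hhm : ∀ i, h (s i) ∈ m := fun i => by
    have : h (s i) = s i - n (s i) := by rw [eq_sub_iff_add_eq]; exact (hr _).symm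
    rw [this]
    exact m.sub_mem (hsm i) (hnm _)
  let a : Fin k ⊕ Fin k → m := Sum.elim (fun i => ⟨h (s i), hhm i⟩) (fun i => ⟨n (s i), hnm _⟩)
  obtain ⟨y, hy⟩ := hsolv (Fin k ⊕ Fin k) (fun j => a j) (fun j => f (a j))
    (by rintro (i | i); exacts [hh _, hn _]) fun z hz => by
      have : ∑ j, z j • a j = 0 := by
        ext; simpa using hz
      simpa using congrArg f this
  refine ⟨y, ?_⟩
  have key : ∀ x (hx : x ∈ Submodule.span R (Set.range s)) (hxm : x ∈ m),
      f ⟨x, hxm⟩ = x * y := by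
    intro x hx
    induction hx using Submodule.span_induction with
    | mem x hx =>
      obtain ⟨i, rfl⟩ := hx
      intro hxm
      have e : (⟨s i, hxm⟩ : m) = a (Sum.inl i) + a (Sum.inr i) := by
        ext; exact hr (s i)
      rw [e, map_add, ← hy, ← hy, ← add_mul]
      exact congrArg (· * y) (hr (s i)).symm
    | zero => intro hxm; rw [zero_mul]; exact map_zero f
    | add x x' hx hx' h1 h2 =>
      intro hxm
      rw [add_mul, ← h1 (hs ▸ hx), ← h2 (hs ▸ hx'), ← map_add]
      rfl
    | smul r x hx h1 =>
      intro hxm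
      rw [smul_mul_assoc, ← h1 (hs ▸ hx), ← map_smul]
      rfl
  exact fun a => key a (hs.symm ▸ a.2) a.2

variable {R : Type w} [Ring R] (𝒜 : ℤ → AddSubgroup R)

theorem IsLeftGradedCoherent.of_isNoetherianRing [IsNoetherianRing R] :
    IsLeftGradedCoherent 𝒜 := by
  intro N L _ _ _ _ 𝒩 ℒ f _ _ _ _ _
  have : Module.Finite R (LinearMap.ker f) := inferInstance
  exact Module.finitePresentation_of_finite R _

/-- If `R` is self-injective and the grading comes with compatible projections, then `R` is
injective among graded modules. -/
theorem IsLeftGradedInjective.of_injective [Module.Injective R R] (p : ℤ → R →+ R)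
    (hp : ∀ i x, p i x ∈ 𝒜 i) (hp' : ∀ i, ∀ x ∈ 𝒜 i, p i x = x)
    (hpmul : ∀ i j, ∀ a ∈ 𝒜 i, ∀ x, p (i + j) (a * x) = a * p j x)
    (h𝒜 : ∀ r : R, r ∈ AddSubgroup.closure (⋃ i, (𝒜 i : Set R))) :
    IsLeftGradedInjective 𝒜 := by
  intro N L _ _ _ _ 𝒩 ℒ i f h𝒩 hℒ _ _ hi hinj hf
  obtain ⟨g, hg⟩ := Module.Injective.out i hinj f
  let _ := hℒ.isInternal.chooseDecomposition
  -- The degree-preserving part of the ungraded extension `g`: on `ℒ j`, apply `g` and project to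
  -- degree `j`.
  let g₀ : L →+ R := (DirectSum.toAddMonoid fun j =>
    ((p j).comp g.toAddMonoidHom).comp (ℒ j).subtype).comp
      (DirectSum.decomposeAddEquiv ℒ).toAddMonoidHom
  have hg₀ : ∀ j, ∀ x ∈ ℒ j, g₀ x = p j (g x) := by
    intro j x hx
    change DirectSum.toAddMonoid _ (DirectSum.decompose ℒ x) = _
    rw [DirectSum.decompose_of_mem ℒ hx, DirectSum.toAddMonoid_of]
    rfl
  have hℒind : ∀ (P : L → Prop), P 0 → (∀ j, ∀ x ∈ ℒ j, P x) →
      (∀ x y, P x → P y → P (x + y)) → ∀ x, P x := fun P h0 h1 h2 x =>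
    DirectSum.Decomposition.inductionOn ℒ h0 (fun m => h1 _ _ m.2) h2 x
  let _ := h𝒩.isInternal.chooseDecomposition
  refine ⟨{ g₀ with map_smul' := fun r x => ?_ }, fun j x hx => ?_, ?_⟩
  · change g₀ (r • x) = r * g₀ x
    induction h𝒜 r using AddSubgroup.closure_induction with
    | mem a ha =>
      obtain ⟨k, hk⟩ := Set.mem_iUnion.1 ha
      refine hℒind (fun x => g₀ (a • x) = a * g₀ x) (by simp) (fun j x hx => ?_)
        (fun x y hx hy => by rw [smul_add, map_add, map_add, mul_add, hx, hy]) x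
      rw [hg₀ j x hx, hg₀ _ _ (hℒ.smul_mem k j a x hk hx), map_smul, smul_eq_mul,
        hpmul k j a hk]
    | zero => simp
    | add a b _ _ ha hb => rw [add_smul, map_add, ha, hb, add_mul]
    | neg a _ ha => rw [neg_smul, map_neg, ha, neg_mul]
  · change g₀ x ∈ _
    rw [hg₀ j x hx]
    exact hp _ _
  · ext x
    change g₀ (i x) = f x
    refine DirectSum.Decomposition.inductionOn 𝒩 (motive := fun x => g₀ (i x) = f x) (by simp)
      (fun {j} m => ?_) (fun x y hx hy => by simp only [map_add, hx, hy]) x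
    rw [hg₀ j _ (hi _ _ m.2), hg, hp' _ _ (hf _ _ m.2)]

theorem mem_opGrading {i : ℤ} {x : Rᵐᵒᵖ} : x ∈ opGrading 𝒜 i ↔ x.unop ∈ 𝒜 i := by
  constructor
  · rintro ⟨y, hy, rfl⟩
    exact hy
  · intro h
    exact ⟨x.unop, h, rfl⟩

end Rings

/-! ### Weak cokernels and injectivity of representable modules -/

section WeakCokernels

/-- `f` is a weak cokernel of `z`. -/
def IsWeakCokernelOf {C : Type u} [Category.{v} C] [HasZeroMorphisms C] {Z V W : C} (z : Z ⟶ V)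
    (f : V ⟶ W) : Prop :=
  z ≫ f = 0 ∧ ∀ (Y : C) (φ : V ⟶ Y), z ≫ φ = 0 → ∃ ψ : W ⟶ Y, f ≫ ψ = φ

variable {C : Type u} [Category.{v} C] [Preadditive C]

/-- Evaluation of a morphism out of a representable module. -/
def evalHom {X : C} {F : Cᵒᵖ ⥤ AddCommGrpCat.{v}} (p : preadditiveYoneda.obj X ⟶ F) (T : C)
    (t : T ⟶ X) : F.obj (op T) :=
  (p.app (op T)).hom t

theorem evalHom_eq {X : C} {F : Cᵒᵖ ⥤ AddCommGrpCat.{v}}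
    (p : preadditiveYoneda.obj X ⟶ F) {T : C} (t : T ⟶ X) :
    evalHom p T t = (F.map t.op).hom (evalHom p X (𝟙 X)) :=
  (congrArg (evalHom p T) (Category.comp_id t).symm).trans
    (congrArg (fun q => q.hom (𝟙 X)) (p.naturality t.op))

theorem evalHom_ext {X : C} {F : Cᵒᵖ ⥤ AddCommGrpCat.{v}} {p q : preadditiveYoneda.obj X ⟶ F}
    (h : evalHom p X (𝟙 X) = evalHom q X (𝟙 X)) : p = q := by
  ext T t
  exact ((evalHom_eq p (T := T.unop) t).trans (by rw [h])).trans (evalHom_eq q (T := T.unop) t).symm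

/-- The morphism out of a representable module attached to an element. -/
def elementHom {F : Cᵒᵖ ⥤ AddCommGrpCat.{v}} [F.Additive] {X : C} (x : F.obj (op X)) :
    preadditiveYoneda.obj X ⟶ F where
  app T := AddCommGrpCat.ofHom (AddMonoidHom.mk' (fun t : T.unop ⟶ X => (F.map t.op).hom x)
    fun s t => congrArg (fun q => q.hom x)
      (F.map_add (f := Quiver.Hom.op (X := T.unop) s) (g := Quiver.Hom.op (X := T.unop) t)))
  naturality S T f := by
    ext t
    exact congrArg (fun q => q.hom x) (F.map_comp (Quiver.Hom.op (X := S.unop) t) f)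

theorem evalHom_elementHom {F : Cᵒᵖ ⥤ AddCommGrpCat.{v}} [F.Additive] {X : C}
    (x : F.obj (op X)) : evalHom (elementHom x) X (𝟙 X) = x :=
  congrArg (fun q => q.hom x) (F.map_id (op X))

/-- By the Yoneda lemma an element of `F(X)` is a morphism from a representable module, which itself
lies in `mod C`, so a monomorphism can be cancelled. -/
theorem injective_app_of_mono {F G : ModCat C} (i : F ⟶ G) [Mono i] (X : C) :
    Function.Injective (i.hom.app (op X)).hom := by
  rw [injective_iff_map_eq_zero]
  intro x hx
  have := F.property.1
  let p : representableModule X ⟶ F := ObjectProperty.homMk (elementHom x)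
  have hp : p = 0 := by
    rw [← cancel_mono i, zero_comp]
    ext1
    refine evalHom_ext ?_
    change (i.hom.app (op X)).hom (evalHom (elementHom x) X (𝟙 X)) = 0
    rw [evalHom_elementHom]
    exact hx
  rw [← evalHom_elementHom x]
  exact congrArg (fun q : representableModule X ⟶ F => evalHom q.hom X (𝟙 X)) hp

/-- Morphisms out of a module with generator `p` can be defined on the generator. -/
theorem exists_fac_of_surjective {A Y : C} {F : Cᵒᵖ ⥤ AddCommGrpCat.{v}}
    (p : preadditiveYoneda.obj A ⟶ F) (hp : ∀ T : C, Function.Surjective (evalHom p T))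
    (ψ : A ⟶ Y) (hψ : ∀ (T : C) (t : T ⟶ A), evalHom p T t = 0 → t ≫ ψ = 0) :
    ∃ q : F ⟶ preadditiveYoneda.obj Y, p ≫ q = preadditiveYoneda.map ψ := by
  have hadd : ∀ (T : C) (s t : T ⟶ A), evalHom p T (s + t) = evalHom p T s + evalHom p T t :=
    fun T s t => map_add (p.app (op T)).hom (s : T ⟶ A) t
  have hsub : ∀ (T : C) (s t : T ⟶ A), evalHom p T (s - t) = evalHom p T s - evalHom p T t :=
    fun T s t => map_sub (p.app (op T)).hom (s : T ⟶ A) t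
  have hwd : ∀ (T : C) (s t : T ⟶ A), evalHom p T s = evalHom p T t → s ≫ ψ = t ≫ ψ := by
    intro T s t h
    rw [← sub_eq_zero, ← Preadditive.sub_comp]
    exact hψ T _ (by rw [hsub, h, sub_self])
  let q (T : Cᵒᵖ) (x : F.obj T) : T.unop ⟶ Y := (hp T.unop x).choose ≫ ψ
  have hq : ∀ (T : C) (t : T ⟶ A), q (op T) (evalHom p T t) = t ≫ ψ := fun T t =>
    hwd T _ _ (hp T (evalHom p T t)).choose_spec
  refine ⟨{ app := fun T => AddCommGrpCat.ofHom (AddMonoidHom.mk' (q T) ?_)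
            naturality := ?_ }, ?_⟩
  · intro x y
    obtain ⟨s, rfl⟩ := hp T.unop x
    obtain ⟨t, rfl⟩ := hp T.unop y
    refine (congrArg (q T) (hadd _ s t).symm).trans ?_
    refine (hq T.unop (s + t)).trans ?_
    rw [Preadditive.add_comp]
    exact congrArg₂ (· + ·) (hq T.unop s).symm (hq T.unop t).symm
  · intro S T f
    ext x
    obtain ⟨s, rfl⟩ := hp S.unop x
    have e : (F.map f).hom (evalHom p S.unop s) = evalHom p T.unop (f.unop ≫ s) :=
      (congrArg (fun q => q.hom s) (p.naturality f)).symm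
    change q T ((F.map f).hom (evalHom p S.unop s)) = f.unop ≫ q S (evalHom p S.unop s)
    rw [e]
    refine (hq T.unop _).trans ?_
    rw [Category.assoc]
    exact congrArg (f.unop ≫ ·) (hq S.unop s).symm
  · ext T t
    exact hq T.unop t

/-- Lift `i : F ⟶ G` to a map `a : A ⟶ A'` of generators, and let `g'` be the relations of `G`. A
map `β : A ⟶ X` representing `φ` extends to `G` exactly when some `ψ` satisfies `a ≫ ψ = β` and `g'
≫ ψ = 0`, that is, when `(β, 0)` factors through `(a, g')`. -/
theorem injective_representableModule [HasBinaryBiproducts C]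
    (h : ∀ {V W : C} (f : V ⟶ W), ∃ (Z : C) (z : Z ⟶ V), IsWeakCokernelOf z f) (X : C) :
    Injective (representableModule X) := by
  refine ⟨fun {F G} φ i hi => ?_⟩
  obtain ⟨hF, A, B, g, p, hp⟩ := F.property
  obtain ⟨hG, A', B', g', p', hp'⟩ := G.property
  have hps : ∀ T : C, Function.Surjective (evalHom p T) := fun T => (hp (op T)).2
  have hps' : ∀ T : C, Function.Surjective (evalHom p' T) := fun T => (hp' (op T)).2
  obtain ⟨a, ha⟩ := hps' A (evalHom (p ≫ i.hom) A (𝟙 A))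
  have hai : preadditiveYoneda.map a ≫ p' = p ≫ i.hom := evalHom_ext (by
    rw [← ha]
    exact congrArg (evalHom p' A) (Category.id_comp a))
  have hai' : ∀ (T : C) (t : T ⟶ A), evalHom p' T (t ≫ a) =
      (i.hom.app (op T)).hom (evalHom p T t) := fun T t =>
    congrArg (fun q => evalHom q T t) hai
  have hg' : ∀ (T : C) (t : T ⟶ B'), evalHom p' T (t ≫ g') = 0 := fun T t =>
    (hp' (op T)).1.apply_apply_eq_zero t
  have hadd : ∀ (T : C) (s t : T ⟶ A'), evalHom p' T (s + t) = evalHom p' T s + evalHom p' T t :=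
    fun T s t => map_add (p'.app (op T)).hom (s : T ⟶ A') t
  let β : A ⟶ X := evalHom (p ≫ φ.hom) A (𝟙 A)
  have hβ : preadditiveYoneda.map β = p ≫ φ.hom := evalHom_ext (Category.id_comp β)
  have hφ : ∀ (T : C) (t : T ⟶ A), evalHom p T t = 0 → t ≫ β = 0 := by
    intro T t ht
    refine (congrArg (fun q => evalHom q T t) hβ).trans ?_
    change (φ.hom.app (op T)).hom (evalHom p T t) = 0
    rw [ht]
    exact map_zero _
  obtain ⟨Z, z, hz, hZ⟩ := h (biprod.desc a g')
  obtain ⟨ψ, hψ⟩ := hZ X (biprod.desc β 0) (by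
    have h0 : (z ≫ biprod.fst) ≫ a + (z ≫ biprod.snd) ≫ g' = 0 := by
      rw [← hz, Category.assoc, Category.assoc, ← Preadditive.comp_add, biprod.desc_eq]
    -- Composed with `a`, the first component of `z` becomes a relation of `G`; its class in `F` is
    -- therefore killed by the injective map `i`.
    have h1 : evalHom p Z (z ≫ biprod.fst) = 0 := by
      apply injective_app_of_mono i Z
      rw [← hai']
      have h2 := hadd Z ((z ≫ biprod.fst) ≫ a) ((z ≫ biprod.snd) ≫ g')
      rw [h0, hg', add_zero] at h2
      exact h2.symm.trans ((map_zero (p'.app (op Z)).hom).trans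
        (map_zero (i.hom.app (op Z)).hom).symm)
    have h3 := hφ Z _ h1
    rw [biprod.desc_eq, comp_zero, add_zero, ← Category.assoc]
    exact h3)
  have hψa : a ≫ ψ = β := by
    have := congrArg (biprod.inl ≫ ·) hψ
    simpa using this
  have hψg : g' ≫ ψ = 0 := by
    have := congrArg (biprod.inr ≫ ·) hψ
    simpa using this
  obtain ⟨q, hq⟩ := exists_fac_of_surjective p' hps' ψ fun T t ht => by
    obtain ⟨s, hs⟩ := ((hp' (op T)).1 t).1 ht
    have hs' : (show T ⟶ B' from s) ≫ g' = t := hs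
    rw [← hs', Category.assoc, hψg, comp_zero]
  refine ⟨ObjectProperty.homMk q, ?_⟩
  ext1
  ext T x
  obtain ⟨t, rfl⟩ := hps T.unop x
  have e : p ≫ i.hom ≫ q = p ≫ φ.hom := by
    rw [← Category.assoc, ← hai, Category.assoc, hq, ← Functor.map_comp, hψa, hβ]
  exact congrArg (fun r => evalHom r T.unop t) e

/-- The image of a morphism of representable modules. -/
def yonedaImage {V W : C} (f : V ⟶ W) : Cᵒᵖ ⥤ AddCommGrpCat.{v} where
  obj T := AddCommGrpCat.of ((preadditiveYoneda.map f).app T).hom.range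
  map {S T} g := AddCommGrpCat.ofHom
    ((((preadditiveYoneda.obj W).map g).hom.comp (AddSubgroup.subtype _)).codRestrict
      ((preadditiveYoneda.map f).app T).hom.range (by
        rintro ⟨_, ⟨t, rfl⟩⟩
        exact ⟨((preadditiveYoneda.obj V).map g).hom t,
          congrArg (fun q => q.hom t) ((preadditiveYoneda.map f).naturality g)⟩))
  map_id T := by
    ext x
    exact congrArg (fun q => q.hom x.1) ((preadditiveYoneda.obj W).map_id T)
  map_comp g h := by
    ext x
    exact congrArg (fun q => q.hom x.1) ((preadditiveYoneda.obj W).map_comp g h)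

/-- The inclusion of the image. -/
def yonedaImageι {V W : C} (f : V ⟶ W) : yonedaImage f ⟶ preadditiveYoneda.obj W where
  app _ := AddCommGrpCat.ofHom (AddSubgroup.subtype _)

/-- The projection onto the image. -/
def yonedaImageπ {V W : C} (f : V ⟶ W) : preadditiveYoneda.obj V ⟶ yonedaImage f where
  app T := AddCommGrpCat.ofHom ((preadditiveYoneda.map f).app T).hom.rangeRestrict
  naturality S T g := by
    ext x
    exact Subtype.ext (congrArg (fun q => q.hom x) ((preadditiveYoneda.map f).naturality g))

instance {V W : C} (f : V ⟶ W) : (yonedaImage f).Additive where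
  map_add {S T g h} := by
    ext x
    exact Subtype.ext (congrArg (fun q => q.hom x.1)
      ((preadditiveYoneda.obj W).map_add (f := g) (g := h)))

/-- If `Z ⟶ V` is a weak kernel of `V ⟶ W`, then morphisms from `V` to `X` killed by `Z` extend
to `W` whenever the representable module of `X` is injective. -/
theorem exists_desc_of_injective {Z V W X : C} (z : Z ⟶ V) (f : V ⟶ W) (hzf : z ≫ f = 0)
    (hker : ∀ (T : C) (t : T ⟶ V), t ≫ f = 0 → ∃ s : T ⟶ Z, s ≫ z = t)
    (hX : Injective (representableModule X)) (φ : V ⟶ X) (hφ : z ≫ φ = 0) :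
    ∃ ψ : W ⟶ X, f ≫ ψ = φ := by
  have hπ : ∀ T : C, Function.Surjective (evalHom (yonedaImageπ f) T) := fun T =>
    AddMonoidHom.rangeRestrict_surjective _
  have hex : ∀ (T : C) (t : T ⟶ V), evalHom (yonedaImageπ f) T t = 0 → t ≫ f = 0 :=
    fun T t ht => congrArg Subtype.val ht
  -- The weak kernel supplies the relations of the image of `f`, which is why the image lies in `mod
  -- C` and can be tested against an injective object.
  let F : ModCat C := ⟨yonedaImage f, inferInstance, V, Z, z, yonedaImageπ f, fun T =>
    ⟨fun t => ⟨fun ht => hker T.unop t (hex T.unop t ht), by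
      rintro ⟨s, rfl⟩
      refine Subtype.ext ?_
      exact (Category.assoc (show T.unop ⟶ Z from s) z f).trans (by rw [hzf, comp_zero]; rfl)⟩,
      hπ T.unop⟩⟩
  let i : F ⟶ representableModule W := ObjectProperty.homMk (yonedaImageι f)
  have hi : Mono i := by
    refine ⟨fun {G} a b hab => ?_⟩
    ext1
    ext T x
    exact Subtype.ext (congrArg (fun q : G ⟶ representableModule W => (q.hom.app T).hom x) hab)
  obtain ⟨q, hq⟩ := exists_fac_of_surjective (yonedaImageπ f) hπ φ fun T t ht => by
    obtain ⟨s, rfl⟩ := hker T t (hex T t ht)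
    rw [Category.assoc, hφ, comp_zero]
  obtain ⟨ψ, hψ⟩ := hX.factors (ObjectProperty.homMk q : F ⟶ representableModule X) i
  refine ⟨evalHom ψ.hom W (𝟙 W), ?_⟩
  have h1 : yonedaImageπ f ≫ yonedaImageι f ≫ ψ.hom = preadditiveYoneda.map φ := by
    rw [← hq]
    exact congrArg (fun r => yonedaImageπ f ≫ r.hom) hψ
  have h2 : evalHom (yonedaImageπ f ≫ yonedaImageι f ≫ ψ.hom) V (𝟙 V) = evalHom ψ.hom V f :=
    congrArg (evalHom ψ.hom V) (Category.id_comp f)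
  refine (evalHom_eq ψ.hom f).symm.trans (h2.symm.trans ?_)
  rw [h1]
  exact Category.id_comp φ

end WeakCokernels

/-! ### Additive closures in terms of factorizations of identities -/

section Sums

variable {C : Type u} [Category.{v} C] [Preadditive C]

/-- `f` is a finite sum of morphisms factoring through objects satisfying `P`. -/
def FactorsThroughSum (P : ObjectProperty C) {X Y : C} (f : X ⟶ Y) : Prop :=
  ∃ (ι : Type) (_ : Fintype ι) (F : ι → C) (_ : ∀ j, P (F j)) (p : ∀ j, X ⟶ F j)
    (i : ∀ j, F j ⟶ Y), f = ∑ j, p j ≫ i j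

namespace FactorsThroughSum

variable {P : ObjectProperty C} {X Y Z : C}

theorem zero : FactorsThroughSum P (0 : X ⟶ Y) :=
  ⟨Empty, inferInstance, Empty.elim, fun j => j.elim, fun j => j.elim, fun j => j.elim, by simp⟩

theorem of_fac {A : C} (hA : P A) (f : X ⟶ A) (g : A ⟶ Y) : FactorsThroughSum P (f ≫ g) :=
  ⟨Unit, inferInstance, fun _ => A, fun _ => hA, fun _ => f, fun _ => g, by simp⟩

theorem add {f g : X ⟶ Y} (hf : FactorsThroughSum P f) (hg : FactorsThroughSum P g) :
    FactorsThroughSum P (f + g) := by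
  obtain ⟨ι, _, F, hF, p, i, rfl⟩ := hf
  obtain ⟨κ, _, G, hG, q, j, rfl⟩ := hg
  exact ⟨ι ⊕ κ, inferInstance, Sum.elim F G, Sum.rec hF hG, Sum.rec p q, Sum.rec i j, by simp⟩

theorem sum {κ : Type*} (s : Finset κ) {f : κ → (X ⟶ Y)} (hf : ∀ j, FactorsThroughSum P (f j)) :
    FactorsThroughSum P (∑ j ∈ s, f j) := by
  classical
  induction s using Finset.induction_on with
  | empty => simpa using zero
  | insert a s ha ih => rw [Finset.sum_insert ha]; exact (hf a).add ih

theorem comp {f : X ⟶ Y} (hf : FactorsThroughSum P f) (g : Y ⟶ Z) :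
    FactorsThroughSum P (f ≫ g) := by
  obtain ⟨ι, _, F, hF, p, i, rfl⟩ := hf
  exact ⟨ι, inferInstance, F, hF, p, fun j => i j ≫ g, by simp [Preadditive.sum_comp]⟩

theorem precomp {g : Y ⟶ Z} (hg : FactorsThroughSum P g) (f : X ⟶ Y) :
    FactorsThroughSum P (f ≫ g) := by
  obtain ⟨ι, _, F, hF, p, i, rfl⟩ := hg
  exact ⟨ι, inferInstance, F, hF, fun j => f ≫ p j, i, by simp [Preadditive.comp_sum]⟩

/-- Replace `P` by `Q` if the identities of objects satisfying `P` factor through `Q`. -/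
theorem trans {Q : ObjectProperty C} {f : X ⟶ Y} (hf : FactorsThroughSum P f)
    (h : ∀ A, P A → FactorsThroughSum Q (𝟙 A)) : FactorsThroughSum Q f := by
  obtain ⟨ι, _, F, hF, p, i, rfl⟩ := hf
  refine sum _ fun j => ?_
  have := ((h _ (hF j)).comp (i j)).precomp (p j)
  simpa using this

theorem mono {Q : ObjectProperty C} {f : X ⟶ Y} (hf : FactorsThroughSum P f) (h : P ≤ Q) :
    FactorsThroughSum Q f := by
  obtain ⟨ι, _, F, hF, p, i, rfl⟩ := hf
  exact ⟨ι, inferInstance, F, fun j => h _ (hF j), p, i, rfl⟩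

theorem map {D : Type*} [Category* D] [Preadditive D] (G : C ⥤ D) [G.Additive]
    {Q : ObjectProperty D} (hQ : ∀ A, P A → Q (G.obj A)) {f : X ⟶ Y}
    (hf : FactorsThroughSum P f) : FactorsThroughSum Q (G.map f) := by
  obtain ⟨ι, _, F, hF, p, i, rfl⟩ := hf
  exact ⟨ι, inferInstance, fun j => G.obj (F j), fun j => hQ _ (hF j), fun j => G.map (p j),
    fun j => G.map (i j), by simp [Functor.map_sum]⟩

/-- Vanishing of a morphism can be tested on objects satisfying `P`. -/
theorem eq_zero_of_forall_comp (h : FactorsThroughSum P (𝟙 X)) (f : X ⟶ Y)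
    (hf : ∀ (A : C) (_ : P A) (g : A ⟶ X), g ≫ f = 0) : f = 0 := by
  obtain ⟨ι, _, F, hF, p, i, e⟩ := h
  rw [← Category.id_comp f, e, Preadditive.sum_comp]
  exact Finset.sum_eq_zero fun j _ => by rw [Category.assoc, hf _ (hF j), comp_zero]

theorem eq_zero_of_forall_precomp (h : FactorsThroughSum P (𝟙 Y)) (f : X ⟶ Y)
    (hf : ∀ (A : C) (_ : P A) (g : Y ⟶ A), f ≫ g = 0) : f = 0 := by
  obtain ⟨ι, _, F, hF, p, i, e⟩ := h
  rw [← Category.comp_id f, e, Preadditive.comp_sum]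
  exact Finset.sum_eq_zero fun j _ => by rw [← Category.assoc, hf _ (hF j), zero_comp]

end FactorsThroughSum

/-- Expanding a retraction from a biproduct into components removes the biproduct, so that
membership in `add P` can be transported along any additive functor. -/
theorem addClosure_iff_factorsThroughSum [HasFiniteBiproducts C] (P : ObjectProperty C) (X : C) :
    addClosure P X ↔ FactorsThroughSum P (𝟙 X) := by
  constructor
  · rintro ⟨n, F, b, hF, ⟨hb⟩, ⟨r⟩⟩
    refine ⟨Fin n, inferInstance, F, hF, fun j => r.i ≫ b.π j, fun j => b.ι j ≫ r.r, ?_⟩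
    have e : r.i ≫ r.r = r.i ≫ (∑ j, b.π j ≫ b.ι j) ≫ r.r := by
      rw [IsBilimit.total hb, Category.id_comp]
    rw [← r.retract, e, Preadditive.sum_comp, Preadditive.comp_sum]
    simp
  · rintro ⟨ι, _, F, hF, p, i, e⟩
    let ε := Fintype.equivFin ι
    let F' : Fin (Fintype.card ι) → C := fun j => F (ε.symm j)
    refine ⟨_, F', biproduct.bicone F', fun j => hF _, ⟨biproduct.isBilimit F'⟩,
      ⟨⟨biproduct.lift fun j => p (ε.symm j), biproduct.desc fun j => i (ε.symm j), ?_⟩⟩⟩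
    rw [biproduct.lift_desc, e]
    exact ε.symm.sum_comp fun j => p j ≫ i j

end Sums

/-! ### Finitely generated modules over hereditary rings -/

section Hereditary

/-- The first coordinate maps `N` onto a left ideal, which is projective, so `N` splits as this
ideal plus a kernel that embeds in one free summand less. -/
theorem IsHereditaryRing.projective_of_injective {R : Type v} [Ring R] (hR : IsHereditaryRing R) :
    ∀ (n : ℕ) (N : Type v) [AddCommGroup N] [Module R N] (f : N →ₗ[R] (Fin n → R)),
      Function.Injective f → Module.Projective R N := by
  intro n
  induction n with
  | zero =>
    intro N _ _ f hf
    have : Subsingleton N := hf.subsingleton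
    infer_instance
  | succ n ih =>
    intro N _ _ f hf
    let q : N →ₗ[R] R := (LinearMap.proj 0).comp f
    have hI : Module.Projective R (LinearMap.range q) := hR _
    have hK : Module.Projective R (LinearMap.ker q) := by
      refine ih _ ((LinearMap.funLeft R R Fin.succ).comp (f.comp (LinearMap.ker q).subtype)) ?_
      rw [injective_iff_map_eq_zero]
      intro x hx
      ext
      apply hf
      rw [Submodule.coe_zero, map_zero]
      funext j
      refine Fin.cases ?_ (fun j => ?_) j
      · exact x.2
      · exact congrFun hx j
    obtain ⟨s, hs⟩ := Module.projective_lifting_property q.rangeRestrict LinearMap.id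
      q.surjective_rangeRestrict
    have hs' : ∀ y, q (s y) = y := fun y => congrArg Subtype.val (LinearMap.congr_fun hs y)
    refine Module.Projective.of_split (M := LinearMap.ker q × LinearMap.range q)
      (LinearMap.prod ((LinearMap.id - s.comp q.rangeRestrict).codRestrict _ fun x => by
        simp [hs']) q.rangeRestrict) ((LinearMap.ker q).subtype.coprod s) ?_
    ext x
    simp

variable {R : Type v} [Ring R] [IsNoetherianRing R]

theorem FGModuleCat.surjective_of_epi {A B : FGModuleCat.{v} R} (f : A ⟶ B) [Epi f] :
    Function.Surjective f.hom.hom :=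
  (ModuleCat.epi_iff_surjective _).1
    (inferInstanceAs (Epi ((forget₂ (FGModuleCat R) (ModuleCat R)).map f)))

theorem FGModuleCat.injective_of_mono {A B : FGModuleCat.{v} R} (f : A ⟶ B) [Mono f] :
    Function.Injective f.hom.hom :=
  (ModuleCat.mono_iff_injective _).1
    (inferInstanceAs (Mono ((forget₂ (FGModuleCat R) (ModuleCat R)).map f)))

theorem FGModuleCat.epi_of_surjective {A B : FGModuleCat.{v} R} (f : A ⟶ B)
    (hf : Function.Surjective f.hom.hom) : Epi f :=
  (forget₂ (FGModuleCat R) (ModuleCat R)).epi_of_epi_map ((ModuleCat.epi_iff_surjective _).2 hf)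

theorem FGModuleCat.projective_of_module {A : FGModuleCat.{v} R} [Module.Projective R A] :
    Projective A where
  factors {E X} f e _ := by
    obtain ⟨h, hh⟩ := Module.projective_lifting_property e.hom.hom f.hom.hom
      (FGModuleCat.surjective_of_epi e)
    exact ⟨ObjectProperty.homMk (ModuleCat.ofHom h), by ext1; exact hh⟩

/-- Every finitely generated module is a quotient of a finitely generated free module. -/
theorem FGModuleCat.exists_epi_free (A : FGModuleCat.{v} R) :
    ∃ (n : ℕ) (p : FGModuleCat.of R (Fin n → R) ⟶ A), Epi p := by
  obtain ⟨n, f, hf⟩ := Module.Finite.exists_fin' R A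
  exact ⟨n, ObjectProperty.homMk (ModuleCat.ofHom f), FGModuleCat.epi_of_surjective _ hf⟩

instance (n : ℕ) : Projective (FGModuleCat.of R (Fin n → R)) :=
  have : Module.Projective R (FGModuleCat.of R (Fin n → R)) :=
    inferInstanceAs (Module.Projective R (Fin n → R))
  FGModuleCat.projective_of_module

/-- Over a hereditary ring every finitely generated module has a projective resolution of
length one. -/
theorem IsHereditaryRing.exists_resolution (hR : IsHereditaryRing R) (A : FGModuleCat.{v} R) :
    ∃ S : ShortComplex (FGModuleCat.{v} R), S.ShortExact ∧ S.X₃ = A ∧ Projective S.X₁ ∧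
      Projective S.X₂ := by
  obtain ⟨n, p, hp⟩ := FGModuleCat.exists_epi_free A
  refine ⟨ShortComplex.mk (kernel.ι p) p (kernel.condition p), ?_, rfl, ?_, inferInstance⟩
  · exact { exact := ShortComplex.exact_of_f_is_kernel _ (kernelIsKernel p) }
  · have : Module.Projective R (kernel p : FGModuleCat R) :=
      hR.projective_of_injective n _ (kernel.ι p).hom.hom (FGModuleCat.injective_of_mono _)
    exact FGModuleCat.projective_of_module

theorem IsHereditaryRing.hasProjectiveDimensionLT (hR : IsHereditaryRing R)
    (A : FGModuleCat.{v} R) : HasProjectiveDimensionLT A 2 := by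
  obtain ⟨S, hS, rfl, h1, h2⟩ := hR.exists_resolution A
  exact hS.hasProjectiveDimensionLT_X₃ 1 inferInstance inferInstance

end Hereditary

/-! ### Shifted morphisms -/

section ShiftedHoms

variable {D : Type*} [Category* D] [HasShift D ℤ]

namespace CategoryTheory.ShiftedHom

/-- The canonical isomorphism `X⟦a⟧ ⟶ X` of degree `a`. -/
def fromShift (X : D) (a : ℤ) : ShiftedHom (X⟦a⟧) X a := 𝟙 _

/-- The canonical isomorphism `X ⟶ X⟦a⟧` of degree `-a`. -/
noncomputable def toShift (X : D) (a : ℤ) : ShiftedHom X (X⟦a⟧) (-a) :=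
  (shiftFunctorCompIsoId D a (-a) (add_neg_cancel a)).inv.app X

theorem toShift_comp_fromShift (X : D) (a : ℤ) :
    (toShift X a).comp (fromShift X a) (add_neg_cancel a) = mk₀ 0 rfl (𝟙 X) := by
  simp [toShift, fromShift, comp, mk₀, shiftFunctorCompIsoId, shiftFunctorZero']

theorem fromShift_comp_toShift (X : D) (a : ℤ) :
    (fromShift X a).comp (toShift X a) (neg_add_cancel a) = mk₀ 0 rfl (𝟙 _) := by
  simp [toShift, fromShift, comp, mk₀, shift_shiftFunctorCompIsoId_inv_app]
  simp [shiftFunctorCompIsoId, shiftFunctorZero']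

/-- Cancelling the two shift isomorphisms allows passage between morphisms of shifted objects and
homogeneous morphisms of the unshifted ones. -/
theorem toShift_comp_fromShift_comp {X Y : D} (a : ℤ) {b c : ℤ} (f : ShiftedHom X Y b)
    (h : b + a = c) (h' : c + -a = b) :
    (toShift X a).comp ((fromShift X a).comp f h) h' = f := by
  rw [← comp_assoc _ _ _ (add_neg_cancel a) h (by lia), toShift_comp_fromShift, mk₀_id_comp]

theorem fromShift_comp_toShift_comp {X Y : D} (a : ℤ) {b c : ℤ} (f : ShiftedHom (X⟦a⟧) Y b)
    (h : b + -a = c) (h' : c + a = b) :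
    (fromShift X a).comp ((toShift X a).comp f h) h' = f := by
  rw [← comp_assoc _ _ _ (neg_add_cancel a) h (by lia), fromShift_comp_toShift, mk₀_id_comp]

variable [Preadditive D]

theorem comp_sum [∀ n : ℤ, (shiftFunctor D n).Additive] {X Y Z : D} {ι : Type*}
    (s : Finset ι) {a b c : ℤ} (f : ShiftedHom X Y a) (g : ι → ShiftedHom Y Z b) (h : b + a = c) :
    f.comp (∑ j ∈ s, g j) h = ∑ j ∈ s, f.comp (g j) h :=
  map_sum (AddMonoidHom.mk' (fun g : ShiftedHom Y Z b => f.comp g h)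
    fun g g' => comp_add f g g' h) g s

end CategoryTheory.ShiftedHom

end ShiftedHoms

/-! ### Bounded complexes over hereditary categories -/

section Derived

open DerivedCategory Pretriangulated Triangulated

variable {A : Type u} [Category.{v} A] [Abelian A] [HasDerivedCategory.{w} A]

instance shift_singleFunctor_isLE (X : A) (i : ℤ) :
    ((singleFunctor A 0).obj X)⟦i⟧.IsLE (-i) :=
  TStructure.t.isLE_shift _ 0 i (-i)

instance shift_singleFunctor_isGE (X : A) (i : ℤ) :
    ((singleFunctor A 0).obj X)⟦i⟧.IsGE (-i) :=
  TStructure.t.isGE_shift _ 0 i (-i)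

theorem shiftedHom_eq_zero_of_neg {X Y : A} {i : ℤ} (hi : i < 0)
    (f : ShiftedHom ((singleFunctor A 0).obj X) ((singleFunctor A 0).obj Y) i) : f = 0 :=
  TStructure.t.zero f 0 (-i)

theorem shiftedHom_eq_zero_of_projectiveDimension {X Y : A} (n : ℕ) [HasProjectiveDimensionLT X n]
    {i : ℤ} (hi : n ≤ i)
    (f : ShiftedHom ((singleFunctor A 0).obj X) ((singleFunctor A 0).obj Y) i) : f = 0 := by
  have := hasExt_of_hasDerivedCategory A
  obtain ⟨m, rfl⟩ := Int.eq_ofNat_of_zero_le (show 0 ≤ i by lia)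
  obtain ⟨e, rfl⟩ := (Abelian.Ext.homEquiv (X := X) (Y := Y)).surjective f
  rw [e.eq_zero_of_hasProjectiveDimensionLT n (by lia)]
  exact Abelian.Ext.zero_hom _ _ _

theorem hom_shift_eq_zero_of_projectiveDimension {X Y : A} (n : ℕ)
    [HasProjectiveDimensionLT X n] {i j : ℤ} (hij : i + n ≤ j)
    (f : ((singleFunctor A 0).obj X)⟦i⟧ ⟶ ((singleFunctor A 0).obj Y)⟦j⟧) : f = 0 := by
  have h := ShiftedHom.fromShift_comp_toShift_comp i (b := j) (c := j - i) f (by lia) (by lia)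
  rw [← h, shiftedHom_eq_zero_of_projectiveDimension n (by lia)
    ((ShiftedHom.toShift ((singleFunctor A 0).obj X) i).comp f _), ShiftedHom.comp_zero]

/-- The shifts `X⟦i⟧` of objects of `A` with `-b ≤ i`. -/
def isShiftOfObject (b : ℤ) : ObjectProperty (DerivedCategory A) := fun Y =>
  ∃ (X : A) (i : ℤ), -b ≤ i ∧ Y = ((singleFunctor A 0).obj X)⟦i⟧

/-- Induction on the number `n` of degrees in `[a, b]`. The truncation triangle splits off the top
cohomology because its connecting map has components in `Ext^i` with `i ≥ 2`. The lower bound on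
shifts in `isShiftOfObject` is what carries this through the induction. -/
theorem factorsThroughSum_of_isGE_of_isLE (hA : ∀ X : A, HasProjectiveDimensionLT X 2) (n : ℕ) :
    ∀ (X : DerivedCategory A) (a b : ℤ), a + n = b + 1 → X.IsGE a → X.IsLE b →
      FactorsThroughSum (isShiftOfObject b) (𝟙 X) := by
  induction n with
  | zero =>
    intro X a b hab _ _
    have : IsZero X := TStructure.t.isZero X b a (by lia)
    rw [this.eq_of_src (𝟙 X) 0]
    exact .zero
  | succ n ih =>
    intro X a b hab hXa hXb
    obtain ⟨Y, Z, hY, hZ, f, g, h, hT⟩ := TStructure.t.exists_triangle X (b - 1) b (by lia)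
    have hY : Y.IsLE (b - 1) := ⟨hY⟩
    have hZ : Z.IsGE b := ⟨hZ⟩
    have hZb : Z.IsLE b := by
      refine TStructure.t.isLE₂ _ (rot_of_distTriang _ hT) b hXb ?_
      have : Y⟦(1 : ℤ)⟧.IsLE (b - 2) := TStructure.t.isLE_shift _ (b - 1) 1 (b - 2)
      exact TStructure.t.isLE_of_le (Y⟦(1 : ℤ)⟧) (b - 2) b
    have hYa : Y.IsGE a := by
      refine TStructure.t.isGE₂ _ (inv_rot_of_distTriang _ hT) a ?_ hXa
      have : Z⟦(-1 : ℤ)⟧.IsGE (b + 1) := TStructure.t.isGE_shift _ b (-1) (b + 1)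
      exact TStructure.t.isGE_of_ge (Z⟦(-1 : ℤ)⟧) a (b + 1)
    have hY' := ih Y a (b - 1) (by lia) hYa hY
    obtain ⟨B, ⟨e⟩⟩ := exists_iso_singleFunctor_obj_of_isGE_of_isLE Z b
    let e' : Z ≅ ((singleFunctor A 0).obj B)⟦-b⟧ :=
      e ≪≫ (((singleFunctors A).shiftIso (-b) b 0 (by lia)).app B).symm
    -- The summands of `Y` are shifts by at least `-(b - 1)`, those of `Y⟦1⟧` by at least `-b + 2`,
    -- while `Z` is a shift by `-b`: a gap of at least 2.
    have hh : h = 0 := by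
      have hY1 : FactorsThroughSum (fun W => ∃ (X : A) (i : ℤ), -b + 2 ≤ i ∧
          Nonempty (W ≅ ((singleFunctor A 0).obj X)⟦i⟧)) ((shiftFunctor _ (1 : ℤ)).map (𝟙 Y)) := by
        refine hY'.map (shiftFunctor (DerivedCategory A) (1 : ℤ)) ?_
        rintro _ ⟨X, i, hi, rfl⟩
        exact ⟨X, i + 1, by lia, ⟨((shiftFunctorAdd' _ i 1 _ rfl).app _).symm⟩⟩
      rw [CategoryTheory.Functor.map_id] at hY1
      refine hY1.eq_zero_of_forall_precomp h ?_
      rintro W ⟨X', i, hi, ⟨e''⟩⟩ g'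
      have := hA B
      have := hom_shift_eq_zero_of_projectiveDimension 2 (by lia)
        (e'.inv ≫ h ≫ g' ≫ e''.hom)
      rw [← cancel_mono e''.hom, ← cancel_epi e'.inv, Category.assoc, this]
      simp
    obtain ⟨s, hs⟩ : ∃ s : Z ⟶ X, 𝟙 Z = s ≫ g :=
      Triangle.coyoneda_exact₃ _ hT (𝟙 Z) (by rw [hh]; exact comp_zero)
    obtain ⟨r, hr⟩ : ∃ r : X ⟶ Y, 𝟙 X - g ≫ s = r ≫ f :=
      Triangle.coyoneda_exact₂ _ hT (𝟙 X - g ≫ s : X ⟶ X) (by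
        change (𝟙 X - g ≫ s) ≫ g = 0
        rw [Preadditive.sub_comp, Category.assoc, ← hs]
        simp)
    have key : 𝟙 X = r ≫ 𝟙 Y ≫ f + (g ≫ e'.hom) ≫ e'.inv ≫ s := by
      rw [Category.id_comp, ← hr]
      simp
    rw [key]
    refine ((hY'.comp f).precomp r).mono ?_ |>.add (.of_fac ⟨B, -b, le_rfl, rfl⟩ _ _)
    rintro _ ⟨X, i, hi, rfl⟩
    exact ⟨X, i, by lia, rfl⟩

/-- Over a hereditary abelian category, every bounded complex is a direct summand of a finite
direct sum of shifts of objects. -/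
theorem factorsThroughSum_of_bounded (hA : ∀ X : A, HasProjectiveDimensionLT X 2)
    (X : DerivedCategory A) (hX : TStructure.t.bounded X) :
    FactorsThroughSum (fun Y => ∃ (B : A) (i : ℤ), Y = ((singleFunctor A 0).obj B)⟦i⟧)
      (𝟙 X) := by
  obtain ⟨⟨a, ha⟩, ⟨b, hb⟩⟩ := hX
  have ha' : X.IsGE (min a (b + 1)) := TStructure.t.isGE_of_ge X (min a (b + 1)) a
  refine (factorsThroughSum_of_isGE_of_isLE hA (b + 1 - min a (b + 1)).toNat X _ b
    (by lia) ha' hb).mono ?_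
  rintro _ ⟨X, i, -, rfl⟩
  exact ⟨X, i, rfl⟩

theorem bounded_shift_singleFunctor (X : A) (i : ℤ) :
    TStructure.t.bounded (((singleFunctor A 0).obj X)⟦i⟧) :=
  ⟨⟨-i, inferInstance⟩, ⟨-i, inferInstance⟩⟩

end Derived

/-! ### Self-injectivity of the Yoneda category -/

section Pretriangulated

open Pretriangulated ZeroObject

/-- Complete `f` to a triangle on the left; exactness of `Hom(-, Y)` at `V` is the weak cokernel
property. -/
theorem exists_isWeakCokernelOf {C : Type u} [Category.{v} C] [Preadditive C] [HasZeroObject C]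
    [HasShift C ℤ] [∀ n : ℤ, (shiftFunctor C n).Additive] [Pretriangulated C] {V W : C}
    (f : V ⟶ W) : ∃ (Z : C) (z : Z ⟶ V), IsWeakCokernelOf z f := by
  obtain ⟨Z, z, h, hT⟩ := distinguished_cocone_triangle₁ f
  refine ⟨Z, z, comp_distTriang_mor_zero₁₂ _ hT, fun Y φ hφ => ?_⟩
  obtain ⟨ψ, hψ⟩ := Triangle.yoneda_exact₂ _ hT φ hφ
  exact ⟨ψ, hψ.symm⟩

open Pretriangulated.Opposite in
/-- Triangulated categories are self-injective. -/
theorem IsSelfInjectiveCategory.of_pretriangulated (C : Type u) [Category.{v} C] [Preadditive C]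
    [HasZeroObject C] [HasShift C ℤ] [∀ n : ℤ, (shiftFunctor C n).Additive] [Pretriangulated C] :
    IsSelfInjectiveCategory C where
  coherent := ⟨inferInstance, inferInstance⟩
  injective :=
    ⟨fun X => injective_representableModule exists_isWeakCokernelOf X,
      fun X => injective_representableModule exists_isWeakCokernelOf X⟩

/-- A property that always holds defines a triangulated subcategory; this carries the result over to
a Yoneda category that exhausts `Dᵇ`. -/
theorem IsSelfInjectiveCategory.fullSubcategory {C : Type u} [Category.{v} C] [Preadditive C]
    [HasZeroObject C] [HasShift C ℤ] [∀ n : ℤ, (shiftFunctor C n).Additive] [Pretriangulated C]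
    (P : ObjectProperty C) (hP : ∀ X, P X) : IsSelfInjectiveCategory P.FullSubcategory := by
  have : P.IsTriangulated :=
    { exists_zero := ⟨0, isZero_zero C, hP _⟩
      isStableUnderShiftBy := fun _ => ⟨fun _ _ => hP _⟩
      ext₂' := fun _ _ _ _ => ⟨_, hP _, ⟨Iso.refl _⟩⟩ }
  exact IsSelfInjectiveCategory.of_pretriangulated _

end Pretriangulated

theorem FactorsThroughSum.exists_fac {C : Type u} [Category.{v} C] [Preadditive C]
    {P : ObjectProperty C} {U V W T : C} (h : FactorsThroughSum P (𝟙 T)) (f : U ⟶ V) (g : V ⟶ W)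
    (hfg : ∀ (B : C) (_ : P B) (t : V ⟶ B), f ≫ t = 0 → ∃ s : W ⟶ B, g ≫ s = t) (t : V ⟶ T)
    (ht : f ≫ t = 0) : ∃ s : W ⟶ T, g ≫ s = t := by
  obtain ⟨ι, _, F, hF, p, i, e⟩ := h
  choose s hs using fun j => hfg (F j) (hF j) (t ≫ p j) (by rw [← Category.assoc, ht, zero_comp])
  refine ⟨∑ j, s j ≫ i j, ?_⟩
  rw [← Category.comp_id t, e, Preadditive.comp_sum, Preadditive.comp_sum]
  exact Finset.sum_congr rfl fun j _ => by rw [← Category.assoc, hs, Category.assoc]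

/-! ### The Yoneda category and heredity -/

section YonedaCategory

open DerivedCategory Triangulated

variable (R : Type v) [Ring R] [IsNoetherianRing R] [HasDerivedCategory.{w} (FGModuleCat.{v} R)]

theorem IsHereditaryRing.addClosure_isShiftOfModule (hR : IsHereditaryRing R)
    (X : DerivedCategory.Bounded (FGModuleCat.{v} R)) : addClosure (isShiftOfModule R) X := by
  have : HasFiniteBiproducts (DerivedCategory.Bounded (FGModuleCat.{v} R)) :=
    .of_hasFiniteProducts
  rw [addClosure_iff_factorsThroughSum]
  obtain ⟨ι, _, F, hF, p, i, e⟩ := factorsThroughSum_of_bounded hR.hasProjectiveDimensionLT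
    X.obj X.property
  choose B n hB using hF
  have hb : ∀ j, TStructure.t.bounded (F j) := fun j => by
    rw [hB]; exact bounded_shift_singleFunctor _ _
  refine ⟨ι, inferInstance, fun j => ⟨F j, hb j⟩, fun j => ⟨B j, n j, ⟨eqToIso (hB j)⟩⟩,
    fun j => ObjectProperty.homMk (p j), fun j => ObjectProperty.homMk (i j), ?_⟩
  apply (Bounded.ι (C := FGModuleCat.{v} R)).map_injective
  rw [Functor.map_sum]
  exact e

theorem IsHereditaryRing.isSelfInjectiveCategory (hR : IsHereditaryRing R) :
    IsSelfInjectiveCategory (YonedaCategory.{v, w} R) :=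
  .fullSubcategory _ (hR.addClosure_isShiftOfModule R)

theorem addClosure_self {C : Type u} [Category.{v} C] [Preadditive C] [HasFiniteBiproducts C]
    {P : ObjectProperty C} {X : C} (hX : P X) : addClosure P X := by
  rw [addClosure_iff_factorsThroughSum, ← Category.comp_id (𝟙 X)]
  exact .of_fac hX _ _

/-- The embedding of the category of finitely generated modules into its bounded derived
category. -/
noncomputable def boundedSingleFunctor :
    FGModuleCat.{v} R ⥤ DerivedCategory.Bounded (FGModuleCat.{v} R) :=
  TStructure.t.bounded.lift (singleFunctor (FGModuleCat.{v} R) 0)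
    fun _ => ⟨⟨0, inferInstance⟩, ⟨0, inferInstance⟩⟩

instance : (boundedSingleFunctor R).Full :=
  have : (boundedSingleFunctor R ⋙ Bounded.ι).Full :=
    inferInstanceAs (singleFunctor (FGModuleCat.{v} R) 0).Full
  .of_comp_faithful _ Bounded.ι

instance : (boundedSingleFunctor R).Faithful :=
  have : (boundedSingleFunctor R ⋙ Bounded.ι).Faithful :=
    inferInstanceAs (singleFunctor (FGModuleCat.{v} R) 0).Faithful
  .of_comp _ Bounded.ι

/-- The embedding of the category of finitely generated modules into the Yoneda category. -/
noncomputable def yonedaEmbedding : FGModuleCat.{v} R ⥤ YonedaCategory.{v, w} R :=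
  (addClosure (isShiftOfModule R)).lift (boundedSingleFunctor R)
    fun X => by
      have : HasFiniteBiproducts (DerivedCategory.Bounded (FGModuleCat.{v} R)) :=
        .of_hasFiniteProducts
      exact addClosure_self ⟨X, 0, ⟨((shiftFunctorZero _ ℤ).app _).symm⟩⟩

instance : (yonedaEmbedding R).Full :=
  inferInstanceAs ((addClosure (isShiftOfModule R)).lift (boundedSingleFunctor R) _).Full

instance : (yonedaEmbedding R).Faithful :=
  inferInstanceAs ((addClosure (isShiftOfModule R)).lift (boundedSingleFunctor R) _).Faithful

variable {R}

/-- If `P` is projective, then cokernels of morphisms into `P` are weak cokernels in the derived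
category with respect to shifts of objects. -/
theorem exists_fac_singleFunctor {A : Type*} [Category* A] [Abelian A]
    [HasDerivedCategory.{w} A] {P Q L : A} [Projective P] (f : Q ⟶ P) (π : P ⟶ L) [Epi π]
    (hfπ : ∀ (B : A) (g : P ⟶ B), f ≫ g = 0 → ∃ g' : L ⟶ B, π ≫ g' = g) (B : A) (i : ℤ)
    (t : (singleFunctor A 0).obj P ⟶ ((singleFunctor A 0).obj B)⟦i⟧)
    (ht : (singleFunctor A 0).map f ≫ t = 0) :
    ∃ s : (singleFunctor A 0).obj L ⟶ ((singleFunctor A 0).obj B)⟦i⟧,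
      (singleFunctor A 0).map π ≫ s = t := by
  -- There are no morphisms of negative degree, and none of positive degree out of `P`, so only the
  -- module-theoretic factorization in degree 0 has content.
  rcases lt_trichotomy i 0 with hi | rfl | hi
  · exact ⟨0, by rw [comp_zero, shiftedHom_eq_zero_of_neg hi t]⟩
  · let e : ((singleFunctor A 0).obj B)⟦(0 : ℤ)⟧ ≅ (singleFunctor A 0).obj B :=
      (shiftFunctorZero _ ℤ).app _
    obtain ⟨g, hg⟩ := (singleFunctor A 0).map_surjective (t ≫ e.hom)
    obtain ⟨g', hg'⟩ := hfπ B g ((singleFunctor A 0).map_injective (by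
      rw [Functor.map_comp, hg, ← Category.assoc, ht, zero_comp, Functor.map_zero]))
    refine ⟨(singleFunctor A 0).map g' ≫ e.inv, ?_⟩
    rw [← Category.assoc, ← Functor.map_comp, hg', hg, Category.assoc, e.hom_inv_id,
      Category.comp_id]
  · exact ⟨0, by rw [comp_zero, shiftedHom_eq_zero_of_projectiveDimension 1 (by lia) t]⟩

theorem yonedaEmbedding_exists_fac {P Q L : FGModuleCat.{v} R} [Projective P] (f : Q ⟶ P)
    (π : P ⟶ L) [Epi π]
    (hfπ : ∀ (B : FGModuleCat.{v} R) (g : P ⟶ B), f ≫ g = 0 → ∃ g' : L ⟶ B, π ≫ g' = g)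
    (T : YonedaCategory.{v, w} R) (t : (yonedaEmbedding R).obj P ⟶ T)
    (ht : (yonedaEmbedding R).map f ≫ t = 0) :
    ∃ s : (yonedaEmbedding R).obj L ⟶ T, (yonedaEmbedding R).map π ≫ s = t := by
  have : HasFiniteBiproducts (DerivedCategory.Bounded (FGModuleCat.{v} R)) :=
    .of_hasFiniteProducts
  have hT := (addClosure_iff_factorsThroughSum _ _).1 T.property
  have hT' := hT.map (Q := fun Y => ∃ (B : FGModuleCat.{v} R) (i : ℤ),
    Nonempty (Y ≅ ((singleFunctor (FGModuleCat.{v} R) 0).obj B)⟦i⟧))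
    (Bounded.ι (C := FGModuleCat.{v} R)) fun _ h => h
  rw [CategoryTheory.Functor.map_id] at hT'
  obtain ⟨s, hs⟩ := hT'.exists_fac ((singleFunctor (FGModuleCat.{v} R) 0).map f)
    ((singleFunctor (FGModuleCat.{v} R) 0).map π) (by
      rintro Y ⟨B, i, ⟨e⟩⟩ t ht
      obtain ⟨s, hs⟩ := exists_fac_singleFunctor f π hfπ B i (t ≫ e.hom)
        (by rw [← Category.assoc, ht, zero_comp])
      exact ⟨s ≫ e.inv, by rw [← Category.assoc, hs, Category.assoc, e.hom_inv_id,
        Category.comp_id]⟩) t.hom.hom (congrArg (fun q => q.hom.hom) ht)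
  refine ⟨ObjectProperty.homMk (ObjectProperty.homMk s), ?_⟩
  ext1
  ext1
  exact hs

/-- The opposite of `R ⟶ R/I` is a weak kernel of the opposite of `e ≫ ι`, so injectivity for the
representable of `I` factors `ι` through `e ≫ ι`; cancelling the injective `ι` splits `e`. -/
theorem isHereditaryRing_of_representablesAreInjective
    (h : RepresentablesAreInjective (YonedaCategory.{v, w} R)) : IsHereditaryRing R := by
  intro I
  let ι : FGModuleCat.of R I ⟶ FGModuleCat.of R R :=
    ObjectProperty.homMk (ModuleCat.ofHom (Submodule.subtype I))
  have hι : Function.Injective ι.hom.hom := Subtype.val_injective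
  -- Precomposing `ι` with the epimorphism `e` does not change its cokernel, but a factorization of
  -- `ι` through `e ≫ ι` is a splitting, whereas one through `ι` alone would say nothing.
  obtain ⟨n, e, he⟩ := FGModuleCat.exists_epi_free (FGModuleCat.of R I)
  have : Module.Projective R (FGModuleCat.of R R) := inferInstanceAs (Module.Projective R R)
  have : Projective (FGModuleCat.of R R) := FGModuleCat.projective_of_module
  let Y := yonedaEmbedding.{v, w} R
  have hY : ∀ {A B C : FGModuleCat.{v} R} (f : A ⟶ B) (g : B ⟶ C), f ≫ g = 0 →
      Y.map f ≫ Y.map g = 0 := fun f g hfg => by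
    rw [← Functor.map_comp, hfg]
    ext1
    ext1
    exact Functor.map_zero (singleFunctor (FGModuleCat.{v} R) 0) _ _
  obtain ⟨ψ, hψ⟩ := exists_desc_of_injective (Y.map (cokernel.π ι)).op (Y.map (e ≫ ι)).op
    (by rw [← op_comp, hY _ _ (by simp), op_zero])
    (fun T t ht => by
      obtain ⟨s, hs⟩ := yonedaEmbedding_exists_fac (e ≫ ι) (cokernel.π ι)
        (fun B g hg => ⟨cokernel.desc ι g (by
          rwa [← cancel_epi e, comp_zero, ← Category.assoc]), by simp⟩) T.unop t.unop
        (congrArg Quiver.Hom.unop ht)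
      exact ⟨s.op, Quiver.Hom.unop_inj hs⟩)
    (h.2 (op (Y.obj (FGModuleCat.of R I)))) (Y.map ι).op
    (by rw [← op_comp, hY _ _ (by simp), op_zero])
  obtain ⟨s, hs⟩ := Y.map_surjective ψ.unop
  have hsι : s ≫ e ≫ ι = ι := Y.map_injective (by
    rw [Functor.map_comp, hs]
    exact congrArg Quiver.Hom.unop hψ)
  have : Module.Projective R (Fin n → R) := inferInstance
  refine Module.Projective.of_split (M := Fin n → R) s.hom.hom e.hom.hom ?_
  ext x
  exact congrArg (fun q => q.hom.hom x) hsι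

end YonedaCategory

/-! ### Linear equations between shifted endomorphisms -/

section LinearEquations

open Pretriangulated

namespace CategoryTheory.ShiftedHom

variable {D : Type*} [Category* D] [HasShift D ℤ]

theorem comp_fromShift_comp {X Y Z : D} {m b c : ℤ} (z : ShiftedHom X Y m) (f : ShiftedHom Y Z b)
    (h : b + m = c) : z ≫ (fromShift Y m).comp f h = z.comp f h := by
  simp [comp, fromShift]

theorem eq_of_toShift_comp {X Y : D} {a b c : ℤ} {f g : ShiftedHom (X⟦a⟧) Y b} (h : b + -a = c)
    (hfg : (toShift X a).comp f h = (toShift X a).comp g h) : f = g := by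
  rw [← fromShift_comp_toShift_comp a f h (by lia), hfg, fromShift_comp_toShift_comp]

theorem eq_of_fromShift_comp {X Y : D} {a b c : ℤ} {f g : ShiftedHom X Y b} (h : b + a = c)
    (hfg : (fromShift X a).comp f h = (fromShift X a).comp g h) : f = g := by
  rw [← toShift_comp_fromShift_comp a f h (by lia), hfg, toShift_comp_fromShift_comp]

end CategoryTheory.ShiftedHom

theorem prop_of_forall_prop_shift {D : Type*} [Category* D] [HasShift D ℤ] (P : ObjectProperty D)
    [P.IsClosedUnderIsomorphisms] {S : D} (hS : ∀ n : ℤ, P (S⟦n⟧)) : P S :=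
  P.prop_of_iso ((shiftFunctorZero D ℤ).app S) (hS 0)

open ShiftedHom

variable {D : Type*} [Category* D] [Preadditive D] [HasZeroObject D] [HasShift D ℤ]
  [∀ n : ℤ, (shiftFunctor D n).Additive]

variable [Pretriangulated D] (P : ObjectProperty D) [P.IsTriangulated]
  [P.IsClosedUnderIsomorphisms] {S : D}

theorem prop_biproduct_shift (hS : ∀ n : ℤ, P (S⟦n⟧)) [HasFiniteBiproducts D] {ι : Type} [Fintype ι] (n : ι → ℤ) :
    P (⨁ fun j => S⟦n j⟧) :=
  P.prop_of_iso (biproduct.isoProduct _).symm (P.prop_product fun j => hS (n j))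

/-- A system of linear equations `α j * y = β j` is solvable as soon as every left linear relation
between the `α j` holds between the `β j`. -/
theorem exists_comp_eq (hS : ∀ n : ℤ, P (S⟦n⟧))
    (hP : ∀ Z, P Z → FactorsThroughSum (fun Y => ∃ e : ℤ, Y = S⟦e⟧) (𝟙 Z))
    {ι : Type} [Fintype ι] (n : ι → ℤ) (d : ℤ)
    (α : ∀ j, ShiftedHom S S (n j)) (β : ∀ j, ShiftedHom S S (n j + d))
    (hαβ : ∀ (e : ℤ) (c : ∀ j, ShiftedHom S S (e - n j)),
      ∑ j, (c j).comp (α j) (add_sub_cancel (n j) e) = 0 →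
        ∑ j, (c j).comp (β j) (show _ = e + d by lia) = 0) :
    ∃ y : ShiftedHom S S d, ∀ j, (α j).comp y (add_comm _ _) = β j := by
  have : HasFiniteBiproducts D := .of_hasFiniteProducts
  let a (j : ι) : S⟦-n j⟧ ⟶ S := (homEquiv 0 rfl).symm
    ((fromShift S (-n j)).comp (α j) (add_neg_cancel _))
  have ha : ∀ j, mk₀ 0 rfl (a j) = (fromShift S (-n j)).comp (α j) (add_neg_cancel _) := fun j =>
    (homEquiv 0 rfl).apply_symm_apply _
  let b (j : ι) : S⟦-n j⟧ ⟶ S⟦d⟧ := (fromShift S (-n j)).comp (β j) (by lia)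
  -- By exactness of the triangle, a common solution `y` exists as soon as `z` kills the right-hand
  -- sides `b`.
  obtain ⟨Z, z, h, hT⟩ := distinguished_cocone_triangle₁ (biproduct.desc a)
  have hZ : P Z := P.ext_of_isTriangulatedClosed₁ _ hT
    (prop_biproduct_shift P hS fun j => -n j) (prop_of_forall_prop_shift P hS)
  have hz : z ≫ biproduct.desc a = 0 := comp_distTriang_mor_zero₁₂ _ hT
  have hzb : z ≫ biproduct.desc b = 0 := by
    refine (hP Z hZ).eq_zero_of_forall_comp _ ?_
    rintro _ ⟨e, rfl⟩ g
    -- `Z` is a summand of shifts of `S`, so it suffices to test on `g : S⟦e⟧ ⟶ Z`; the components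
    -- of `g ≫ z` are the coefficients of a relation between the `α j`.
    let t (j : ι) : ShiftedHom (S⟦e⟧) S (-n j) := g ≫ z ≫ biproduct.π _ j
    have hta : ∑ j, t j ≫ a j = 0 := by
      have : g ≫ z ≫ biproduct.desc a = 0 := by rw [hz, Limits.comp_zero]
      rw [biproduct.desc_eq, Preadditive.comp_sum, Preadditive.comp_sum] at this
      simpa [t] using this
    have htb : g ≫ z ≫ biproduct.desc b = ∑ j, t j ≫ b j := by
      rw [biproduct.desc_eq, Preadditive.comp_sum, Preadditive.comp_sum]
      simp [t]
    have hta' : ∑ j, (t j).comp (α j) (add_neg_cancel (n j)) = 0 := by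
      have e1 : ∀ j, (t j).comp (α j) (add_neg_cancel (n j)) = mk₀ 0 rfl (t j ≫ a j) := fun j => by
        rw [← comp_fromShift_comp, ← ha]
        simp [mk₀]
      simp only [e1, mk₀]
      rw [← Preadditive.sum_comp, hta, Limits.zero_comp]
    -- Replacing the source `S⟦e⟧` by `S` lowers every degree by `e`.
    have key := hαβ (-e) (fun j => (toShift S e).comp (t j) (by lia)) (by
      have e2 : ∀ j, ((toShift S e).comp (t j) (show _ = -e - n j by lia)).comp (α j)
          (add_sub_cancel (n j) (-e)) =
          (toShift S e).comp ((t j).comp (α j) (add_neg_cancel (n j))) (zero_add (-e)) := fun j =>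
        comp_assoc _ _ _ _ _ (by lia)
      simp only [e2]
      rw [← ShiftedHom.comp_sum, hta', ShiftedHom.comp_zero])
    rw [htb]
    refine eq_of_toShift_comp (show d + -e = -e + d by lia) ?_
    rw [ShiftedHom.comp_zero, ← key, ShiftedHom.comp_sum]
    refine Finset.sum_congr rfl fun j _ => ?_
    rw [comp_fromShift_comp]
    exact (comp_assoc _ _ _ _ _ (by lia)).symm
  obtain ⟨y, hy⟩ : ∃ y : S ⟶ S⟦d⟧, biproduct.desc b = biproduct.desc a ≫ y :=
    Triangle.yoneda_exact₂ _ hT _ hzb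
  refine ⟨y, fun j => eq_of_fromShift_comp (a := -n j) (show _ = d by lia) ?_⟩
  rw [← comp_assoc _ _ _ (add_neg_cancel (n j)) _ (by lia), ← ha, mk₀_comp]
  have := congrArg (biproduct.ι _ j ≫ ·) hy
  simpa using this.symm

/-- A system of linear equations `y * α j = β j` is solvable as soon as every right linear relation
between the `α j` holds between the `β j`. -/
theorem exists_comp_eq' (hS : ∀ n : ℤ, P (S⟦n⟧))
    (hP : ∀ Z, P Z → FactorsThroughSum (fun Y => ∃ e : ℤ, Y = S⟦e⟧) (𝟙 Z))
    {ι : Type} [Fintype ι] (n : ι → ℤ) (d : ℤ)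
    (α : ∀ j, ShiftedHom S S (n j)) (β : ∀ j, ShiftedHom S S (n j + d))
    (hαβ : ∀ (e : ℤ) (c : ∀ j, ShiftedHom S S (e - n j)),
      ∑ j, (α j).comp (c j) (sub_add_cancel e (n j)) = 0 →
        ∑ j, (β j).comp (c j) (show _ = e + d by lia) = 0) :
    ∃ y : ShiftedHom S S d, ∀ j, y.comp (α j) rfl = β j := by
  have : HasFiniteBiproducts D := .of_hasFiniteProducts
  let b (j : ι) : S⟦-d⟧ ⟶ S⟦n j⟧ := (fromShift S (-d)).comp (β j) (by lia)
  let a (j : ι) : S ⟶ S⟦n j⟧ := α j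
  -- Dually, the unknown now comes first, so the triangle is completed on the right and the test
  -- objects are targets of maps out of `Z`.
  obtain ⟨Z, z, h, hT⟩ := distinguished_cocone_triangle (biproduct.lift a)
  have hZ : P Z := P.ext_of_isTriangulatedClosed₃ _ hT (prop_of_forall_prop_shift P hS)
    (prop_biproduct_shift P hS n)
  have hz : biproduct.lift a ≫ z = 0 := comp_distTriang_mor_zero₁₂ _ hT
  have hzb : biproduct.lift b ≫ z = 0 := by
    refine (hP Z hZ).eq_zero_of_forall_precomp _ ?_
    rintro _ ⟨e, rfl⟩ g
    let t (j : ι) : ShiftedHom (S⟦n j⟧) S e := biproduct.ι (fun j => S⟦n j⟧) j ≫ z ≫ g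
    have hta : ∑ j, a j ≫ t j = 0 := by
      have : biproduct.lift a ≫ z ≫ g = 0 := by rw [← Category.assoc, hz, Limits.zero_comp]
      rw [biproduct.lift_eq, Preadditive.sum_comp] at this
      simpa [t] using this
    have htb : (biproduct.lift b ≫ z) ≫ g = ∑ j, b j ≫ t j := by
      rw [biproduct.lift_eq, Preadditive.sum_comp, Preadditive.sum_comp]
      simp [t]
    have ht : ∀ j {X : D} (x : ShiftedHom X S (n j)), x ≫ t j =
        x.comp ((toShift S (n j)).comp (t j) (show _ = e - n j by lia)) (sub_add_cancel e (n j)) :=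
      fun j X x => by
        rw [← comp_fromShift_comp, fromShift_comp_toShift_comp]
    have key := hαβ e (fun j => (toShift S (n j)).comp (t j) (by lia)) (by
      rw [← hta]
      exact Finset.sum_congr rfl fun j _ => (ht j _).symm)
    rw [htb]
    have e3 : ∀ j, b j ≫ t j = (fromShift S (-d)).comp ((β j).comp
        ((toShift S (n j)).comp (t j) (show _ = e - n j by lia)) (show _ = e + d by lia))
        (by lia) := fun j => by
      rw [ht j, comp_assoc _ _ _ _ _ (by lia)]
    simp only [e3]
    rw [← ShiftedHom.comp_sum, key, ShiftedHom.comp_zero]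
  obtain ⟨y, hy⟩ : ∃ y : S⟦-d⟧ ⟶ S, biproduct.lift b = y ≫ biproduct.lift a :=
    Triangle.coyoneda_exact₂ _ hT _ hzb
  refine ⟨(toShift S (-d)).comp (mk₀ 0 rfl y) (by lia), fun j => ?_⟩
  rw [comp_assoc _ _ _ _ (add_zero (n j)) (by lia), mk₀_comp]
  have e4 : y ≫ α j = b j := by
    have := congrArg (· ≫ biproduct.π _ j) hy
    simpa [a] using this.symm
  rw [e4]
  exact toShift_comp_fromShift_comp (-d) (β j) _ _

end LinearEquations

/-! ### Homogeneous elements of the Yoneda algebra -/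

section YonedaAlgebra

open DerivedCategory Abelian

variable {A : Type u} [Category.{v} A] [Abelian A] [HasDerivedCategory.{w'} A] (M : A)

/-- The group `Ext^i(M, M)` for `i : ℤ`, as a group of morphisms in the derived category. -/
abbrev ShiftedEnd (i : ℤ) : Type w' :=
  ShiftedHom ((singleFunctor A 0).obj M) ((singleFunctor A 0).obj M) i

theorem ShiftedEnd.eq_zero_of_neg {M : A} {i : ℤ} (hi : i < 0) (γ : ShiftedEnd M i) : γ = 0 :=
  shiftedHom_eq_zero_of_neg hi γ

variable [HasExt.{w} A]

/-- The inclusion of the homogeneous elements of degree `i`. -/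
noncomputable def ofShiftedEnd : ∀ i : ℤ, ShiftedEnd M i →+ YonedaAlgebra.{u, v, w} M
  | Int.ofNat n => (DirectSum.of (fun n : ℕ => Ext.{w} M M n) n).comp
      (Ext.homAddEquiv (X := M) (Y := M) (n := n)).symm.toAddMonoidHom
  | Int.negSucc _ => 0

/-- The homogeneous component of degree `i`. -/
noncomputable def component : ∀ i : ℤ, YonedaAlgebra.{u, v, w} M →+ ShiftedEnd M i
  | Int.ofNat n => (Ext.homAddEquiv (X := M) (Y := M) (n := n)).toAddMonoidHom.comp
      (DFinsupp.evalAddMonoidHom n)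
  | Int.negSucc _ => 0

variable {M}

theorem ofShiftedEnd_hom {n : ℕ} (α : Ext.{w} M M n) :
    ofShiftedEnd M (n : ℤ) α.hom = DirectSum.of (fun n : ℕ => Ext.{w} M M n) n α := by
  change DirectSum.of (fun n : ℕ => Ext.{w} M M n) n (Ext.homAddEquiv.symm (Ext.homAddEquiv α)) = _
  rw [AddEquiv.symm_apply_apply]

theorem component_natCast (n : ℕ) (x : YonedaAlgebra.{u, v, w} M) :
    component M (n : ℤ) x = (x n).hom := rfl

/-- Integer degrees permit differences such as `e - n j`; this principle reduces statements about
them to zero in negative degrees and to genuine `Ext` classes in the others. -/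
theorem exists_ofShiftedEnd {P : ∀ i : ℤ, ShiftedEnd M i → Prop}
    (hneg : ∀ i < 0, P i 0) (h : ∀ (n : ℕ) (α : Ext.{w} M M n), P n α.hom) (i : ℤ)
    (γ : ShiftedEnd M i) : P i γ := by
  rcases lt_or_ge i 0 with hi | hi
  · rw [γ.eq_zero_of_neg hi]
    exact hneg i hi
  · obtain ⟨n, rfl⟩ := Int.eq_ofNat_of_zero_le hi
    obtain ⟨α, rfl⟩ := (Ext.homEquiv (X := M) (Y := M)).surjective γ
    exact h n α

theorem component_ofShiftedEnd (i : ℤ) (γ : ShiftedEnd M i) :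
    component M i (ofShiftedEnd.{u, v, w} M i γ) = γ := by
  refine exists_ofShiftedEnd.{u, v, w} (P := fun i γ =>
    component M i (ofShiftedEnd.{u, v, w} M i γ) = γ) (fun i _ => by simp) (fun n α => ?_) i γ
  rw [ofShiftedEnd_hom, component_natCast, DirectSum.of_eq_same]

theorem component_ofShiftedEnd_of_ne {i j : ℤ} (hij : i ≠ j) (γ : ShiftedEnd M i) :
    component M j (ofShiftedEnd.{u, v, w} M i γ) = 0 := by
  revert hij
  refine exists_ofShiftedEnd.{u, v, w} (P := fun i γ => i ≠ j →
    component M j (ofShiftedEnd.{u, v, w} M i γ) = 0) (fun i _ _ => by simp) (fun n α h => ?_) i γ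
  rcases lt_or_ge j 0 with hj | hj
  · exact ShiftedEnd.eq_zero_of_neg hj _
  · obtain ⟨m, rfl⟩ := Int.eq_ofNat_of_zero_le hj
    rw [ofShiftedEnd_hom, component_natCast, DirectSum.of_eq_of_ne _ _ _ (by lia)]
    exact map_zero Ext.homAddEquiv

theorem ext_component {x y : YonedaAlgebra.{u, v, w} M}
    (h : ∀ i, component M i x = component M i y) : x = y := by
  refine DFinsupp.ext fun n => ?_
  exact Ext.homEquiv.injective (h n)

theorem yonedaAlgebra_induction {p : YonedaAlgebra.{u, v, w} M → Prop} (x : YonedaAlgebra M)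
    (hof : ∀ i (γ : ShiftedEnd M i), p (ofShiftedEnd M i γ))
    (hadd : ∀ x y, p x → p y → p (x + y)) : p x := by
  induction x using DirectSum.induction_on with
  | zero => simpa using hof 0 0
  | of n α =>
    rw [← ofShiftedEnd_hom]
    exact hof _ _
  | add x y hx hy => exact hadd x y hx hy

theorem ofShiftedEnd_mul {i j k : ℤ} (γ : ShiftedEnd M i) (δ : ShiftedEnd M j) (h : j + i = k) :
    ofShiftedEnd.{u, v, w} M i γ * ofShiftedEnd M j δ = ofShiftedEnd M k (γ.comp δ h) := by
  revert k
  refine exists_ofShiftedEnd.{u, v, w} (P := fun i γ => ∀ {k} (h : j + i = k),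
    ofShiftedEnd.{u, v, w} M i γ * ofShiftedEnd M j δ = ofShiftedEnd M k (γ.comp δ h))
    (fun i _ => by intros; rw [map_zero, zero_mul, ShiftedHom.zero_comp, map_zero])
    (fun n α => ?_) i γ
  refine exists_ofShiftedEnd.{u, v, w} (P := fun j δ => ∀ {k} (h : j + n = k),
    ofShiftedEnd.{u, v, w} M n α.hom * ofShiftedEnd M j δ = ofShiftedEnd M k (α.hom.comp δ h))
    (fun i _ => by intros; rw [map_zero, mul_zero, ShiftedHom.comp_zero, map_zero])
    (fun m β => ?_) j δ
  intro k h
  obtain rfl : k = ((n + m : ℕ) : ℤ) := by push_cast; lia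
  rw [← Ext.comp_hom α β rfl, ofShiftedEnd_hom, ofShiftedEnd_hom, ofShiftedEnd_hom,
    DirectSum.of_mul_of]
  rfl

theorem component_ofShiftedEnd_mul {i j k : ℤ} (γ : ShiftedEnd M i) (x : YonedaAlgebra.{u, v, w} M)
    (h : j + i = k) :
    component M k (ofShiftedEnd M i γ * x) = γ.comp (component M j x) h := by
  induction x using yonedaAlgebra_induction with
  | hof l δ =>
    rw [ofShiftedEnd_mul γ δ rfl]
    by_cases hl : l = j
    · subst hl h
      rw [component_ofShiftedEnd, component_ofShiftedEnd]
    · rw [component_ofShiftedEnd_of_ne hl, component_ofShiftedEnd_of_ne (by lia),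
        ShiftedHom.comp_zero]
  | hadd x y hx hy => rw [mul_add, map_add, map_add, hx, hy, ShiftedHom.comp_add]

theorem component_mul_ofShiftedEnd {i j k : ℤ} (x : YonedaAlgebra.{u, v, w} M) (δ : ShiftedEnd M j)
    (h : j + i = k) :
    component M k (x * ofShiftedEnd M j δ) = (component M i x).comp δ h := by
  induction x using yonedaAlgebra_induction with
  | hof l γ =>
    rw [ofShiftedEnd_mul γ δ rfl]
    by_cases hl : l = i
    · subst hl h
      rw [component_ofShiftedEnd, component_ofShiftedEnd]
    · rw [component_ofShiftedEnd_of_ne hl, component_ofShiftedEnd_of_ne (by lia),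
        ShiftedHom.zero_comp]
  | hadd x y hx hy => rw [add_mul, map_add, map_add, hx, hy, ShiftedHom.add_comp]

variable (M) in
/-- The projection of the Yoneda algebra onto its degree `i` part. -/
noncomputable def degreeProj (i : ℤ) : YonedaAlgebra.{u, v, w} M →+ YonedaAlgebra.{u, v, w} M :=
  (ofShiftedEnd M i).comp (component M i)

theorem mem_yonedaGrading_iff {i : ℤ} {x : YonedaAlgebra.{u, v, w} M} :
    x ∈ yonedaGrading M i ↔ ∃ γ : ShiftedEnd M i, ofShiftedEnd M i γ = x := by
  constructor
  · intro hx
    refine ⟨component M i x, ext_component fun j => ?_⟩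
    by_cases hij : i = j
    · subst hij
      exact component_ofShiftedEnd _ _
    · rw [component_ofShiftedEnd_of_ne hij]
      rcases lt_or_ge j 0 with hj | hj
      · exact (ShiftedEnd.eq_zero_of_neg hj _).symm
      · obtain ⟨m, rfl⟩ := Int.eq_ofNat_of_zero_le hj
        rw [component_natCast, hx m (Ne.symm hij)]
        exact (map_zero Ext.homAddEquiv).symm
  · rintro ⟨γ, rfl⟩ n hn
    apply (Ext.homEquiv (X := M) (Y := M)).injective
    refine (component_ofShiftedEnd_of_ne (Ne.symm hn) γ).trans ?_
    exact (map_zero Ext.homAddEquiv).symm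

theorem degreeProj_mem (i : ℤ) (x : YonedaAlgebra.{u, v, w} M) :
    degreeProj M i x ∈ yonedaGrading M i :=
  mem_yonedaGrading_iff.2 ⟨_, rfl⟩

theorem degreeProj_of_mem {i : ℤ} {x : YonedaAlgebra.{u, v, w} M} (hx : x ∈ yonedaGrading M i) :
    degreeProj M i x = x := by
  obtain ⟨γ, rfl⟩ := mem_yonedaGrading_iff.1 hx
  exact congrArg _ (component_ofShiftedEnd i γ)

theorem degreeProj_mul {i j k : ℤ} (h : j + i = k) {a : YonedaAlgebra.{u, v, w} M}
    (ha : a ∈ yonedaGrading M i) (x : YonedaAlgebra M) :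
    degreeProj M k (a * x) = a * degreeProj M j x := by
  obtain ⟨γ, rfl⟩ := mem_yonedaGrading_iff.1 ha
  change ofShiftedEnd M k _ = ofShiftedEnd M i γ * ofShiftedEnd M j _
  rw [component_ofShiftedEnd_mul γ x h, ofShiftedEnd_mul γ _ h]

theorem degreeProj_mul' {i j k : ℤ} (h : j + i = k) {a : YonedaAlgebra.{u, v, w} M}
    (ha : a ∈ yonedaGrading M j) (x : YonedaAlgebra M) :
    degreeProj M k (x * a) = degreeProj M i x * a := by
  obtain ⟨δ, rfl⟩ := mem_yonedaGrading_iff.1 ha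
  change ofShiftedEnd M k _ = ofShiftedEnd M i _ * ofShiftedEnd M j δ
  rw [component_mul_ofShiftedEnd x δ h, ofShiftedEnd_mul _ δ h]

theorem closure_yonedaGrading (x : YonedaAlgebra.{u, v, w} M) :
    x ∈ AddSubgroup.closure (⋃ i, (yonedaGrading M i : Set (YonedaAlgebra.{u, v, w} M))) := by
  induction x using yonedaAlgebra_induction with
  | hof i γ =>
    exact AddSubgroup.subset_closure (Set.mem_iUnion.2 ⟨i, mem_yonedaGrading_iff.2 ⟨γ, rfl⟩⟩)
  | hadd x y hx hy => exact add_mem hx hy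

end YonedaAlgebra

/-! ### Self-injectivity of the Yoneda algebra of an additive generator -/

/-- If a maximal left ideal omits `n`, it contains some `1 - s * n`, which has the left inverse `1 +
s * n`. -/
theorem mem_ringJacobson_of_mul_self_eq_zero {R : Type*} [Ring R] {n : R}
    (h : ∀ s : R, s * n * (s * n) = 0) : n ∈ Ring.jacobson R := by
  rw [Ring.jacobson_eq_sInf_isMaximal, Submodule.mem_sInf]
  intro (m : Ideal R) (hm : m.IsMaximal)
  by_contra hn
  obtain ⟨s, μ, hμ, e⟩ := hm.exists_inv hn
  refine hm.ne_top ((Ideal.eq_top_iff_one m).2 ?_)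
  have : (1 + s * n) * μ = 1 := by
    have hμ' : μ = 1 - s * n := by rw [← e]; simp
    rw [hμ', mul_sub, mul_one, add_mul, h]
    simp
  rw [← this]
  exact m.mul_mem_left _ hμ

theorem FactorsThroughSum.of_forall_iso {C : Type*} [Category* C] [Preadditive C]
    {P Q : ObjectProperty C} {X Y : C} {f : X ⟶ Y} (hf : FactorsThroughSum P f)
    (h : ∀ A, P A → ∃ B, Q B ∧ Nonempty (A ≅ B)) : FactorsThroughSum Q f :=
  hf.trans fun A hA => by
    obtain ⟨B, hB, ⟨e⟩⟩ := h A hA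
    rw [← e.hom_inv_id]
    exact .of_fac hB _ _

section SelfInjective

open DerivedCategory Abelian Triangulated

variable {A : Type u} [Category.{v} A] [Abelian A] [HasDerivedCategory.{w'} A]
  {M : A}

theorem factorsThroughSum_shift_of_bounded (hA : ∀ X : A, HasProjectiveDimensionLT X 2)
    (hM : ∀ X : A, FactorsThroughSum (fun Y => Nonempty (Y ≅ M)) (𝟙 X))
    (Z : DerivedCategory A) (hZ : TStructure.t.bounded Z) :
    FactorsThroughSum (fun Y => ∃ e : ℤ, Y = ((singleFunctor A 0).obj M)⟦e⟧) (𝟙 Z) := by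
  refine (factorsThroughSum_of_bounded hA Z hZ).trans ?_
  rintro _ ⟨B, i, rfl⟩
  have h := (hM B).map (singleFunctor A 0 ⋙ shiftFunctor (DerivedCategory A) i)
    (Q := fun Y => Nonempty (Y ≅ ((singleFunctor A 0).obj M)⟦i⟧))
    (fun Y ⟨e⟩ => ⟨(singleFunctor A 0 ⋙ shiftFunctor (DerivedCategory A) i).mapIso e⟩)
  rw [CategoryTheory.Functor.map_id] at h
  exact h.of_forall_iso fun Y hY => ⟨_, ⟨i, rfl⟩, hY⟩

variable [HasExt.{w} A]

/-- Solutions found separately in each degree glue to one element, since only degrees 0 and 1 are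
nonzero. -/
theorem component_ofShiftedEnd_add (hA : ∀ X : A, HasProjectiveDimensionLT X 2)
    (y : ∀ d, ShiftedEnd M d) (d : ℤ) :
    component M d (ofShiftedEnd.{u, v, w} M 0 (y 0) + ofShiftedEnd M 1 (y 1)) = y d := by
  rw [map_add]
  have h2 : ∀ {d : ℤ} (_ : 2 ≤ d) (γ : ShiftedEnd M d), γ = 0 := fun hd γ =>
    have := hA M
    shiftedHom_eq_zero_of_projectiveDimension 2 hd γ
  rcases lt_or_ge d 0 with hd | hd
  · rw [(y d).eq_zero_of_neg hd]
    exact ShiftedEnd.eq_zero_of_neg hd _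
  · rcases lt_or_ge d 2 with hd2 | hd2
    · obtain rfl | rfl : d = 0 ∨ d = 1 := by lia
      · rw [component_ofShiftedEnd, component_ofShiftedEnd_of_ne (by lia), add_zero]
      · rw [component_ofShiftedEnd, component_ofShiftedEnd_of_ne (by lia), zero_add]
    · rw [h2 hd2 (y d)]
      exact h2 hd2 _

/-- Only the coefficients `a j` are homogeneous. Comparing components gives one homogeneous system
for each degree `d` of the unknown, and its compatibility condition is the given one for homogeneous
`z`. -/
theorem exists_mul_eq_of_relations (hA : ∀ X : A, HasProjectiveDimensionLT X 2)
    (hM : ∀ X : A, FactorsThroughSum (fun Y => Nonempty (Y ≅ M)) (𝟙 X))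
    (ι : Type) [Fintype ι] (a b : ι → YonedaAlgebra.{u, v, w} M)
    (ha : ∀ j, ∃ (i : ℤ) (γ : ShiftedEnd M i), a j = ofShiftedEnd M i γ)
    (hab : ∀ z : ι → YonedaAlgebra.{u, v, w} M, ∑ j, z j * a j = 0 → ∑ j, z j * b j = 0) :
    ∃ y, ∀ j, a j * y = b j := by
  choose n α hα using ha
  have hd : ∀ d : ℤ, ∃ y : ShiftedEnd M d, ∀ j, (α j).comp y (add_comm _ _) =
      component M (n j + d) (b j) := fun d => by
    refine exists_comp_eq TStructure.t.bounded (bounded_shift_singleFunctor M)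
      (factorsThroughSum_shift_of_bounded hA hM) n d α _ fun e c hc => ?_
    have h0 := hab (fun j => ofShiftedEnd M (e - n j) (c j)) (by
      simp only [hα, ofShiftedEnd_mul _ _ (add_sub_cancel (n _) e)]
      rw [← map_sum, hc, map_zero])
    have h1 := congrArg (component M (e + d)) h0
    rw [map_sum, map_zero] at h1
    rw [← h1]
    exact Finset.sum_congr rfl fun j _ => (component_ofShiftedEnd_mul _ _ _).symm
  choose y hy using hd
  refine ⟨ofShiftedEnd M 0 (y 0) + ofShiftedEnd M 1 (y 1), fun j => ext_component fun i => ?_⟩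
  obtain ⟨d, rfl⟩ : ∃ d, i = n j + d := ⟨i - n j, by ring⟩
  rw [hα, component_ofShiftedEnd_mul _ _ (add_comm d (n j)), component_ofShiftedEnd_add hA y, hy]

theorem exists_mul_eq_of_relations' (hA : ∀ X : A, HasProjectiveDimensionLT X 2)
    (hM : ∀ X : A, FactorsThroughSum (fun Y => Nonempty (Y ≅ M)) (𝟙 X))
    (ι : Type) [Fintype ι] (a b : ι → YonedaAlgebra.{u, v, w} M)
    (ha : ∀ j, ∃ (i : ℤ) (γ : ShiftedEnd M i), a j = ofShiftedEnd M i γ)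
    (hab : ∀ z : ι → YonedaAlgebra.{u, v, w} M, ∑ j, a j * z j = 0 → ∑ j, b j * z j = 0) :
    ∃ y, ∀ j, y * a j = b j := by
  choose n α hα using ha
  have hd : ∀ d : ℤ, ∃ y : ShiftedEnd M d, ∀ j, y.comp (α j) rfl =
      component M (n j + d) (b j) := fun d => by
    refine exists_comp_eq' TStructure.t.bounded (bounded_shift_singleFunctor M)
      (factorsThroughSum_shift_of_bounded hA hM) n d α _ fun e c hc => ?_
    have h0 := hab (fun j => ofShiftedEnd M (e - n j) (c j)) (by
      simp only [hα, ofShiftedEnd_mul _ _ (sub_add_cancel e (n _))]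
      rw [← map_sum, hc, map_zero])
    have h1 := congrArg (component M (e + d)) h0
    rw [map_sum, map_zero] at h1
    rw [← h1]
    exact Finset.sum_congr rfl fun j _ => (component_mul_ofShiftedEnd _ _ _).symm
  choose y hy using hd
  refine ⟨ofShiftedEnd M 0 (y 0) + ofShiftedEnd M 1 (y 1), fun j => ext_component fun i => ?_⟩
  obtain ⟨d, rfl⟩ : ∃ d, i = n j + d := ⟨i - n j, by ring⟩
  rw [hα, component_mul_ofShiftedEnd _ _ rfl, component_ofShiftedEnd_add hA y, hy]

theorem eq_ofShiftedEnd_add (hA : ∀ X : A, HasProjectiveDimensionLT X 2)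
    (x : YonedaAlgebra.{u, v, w} M) :
    x = ofShiftedEnd M 0 (component M 0 x) + ofShiftedEnd M 1 (component M 1 x) :=
  ext_component fun d => (component_ofShiftedEnd_add hA (fun i => component M i x) d).symm

theorem mul_self_eq_zero_of_component_zero (hA : ∀ X : A, HasProjectiveDimensionLT X 2)
    {x : YonedaAlgebra.{u, v, w} M} (hx : component M 0 x = 0) : x * x = 0 := by
  have := hA M
  rw [eq_ofShiftedEnd_add hA x, hx, map_zero, zero_add, ofShiftedEnd_mul _ _ rfl,
    shiftedHom_eq_zero_of_projectiveDimension 2 le_rfl (ShiftedHom.comp _ _ _), map_zero]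

theorem injective_yonedaAlgebra (hA : ∀ X : A, HasProjectiveDimensionLT X 2)
    (hM : ∀ X : A, FactorsThroughSum (fun Y => Nonempty (Y ≅ M)) (𝟙 X))
    [IsArtinianRing (YonedaAlgebra.{u, v, w} M)] [IsNoetherianRing (YonedaAlgebra.{u, v, w} M)] :
    Module.Injective (YonedaAlgebra.{u, v, w} M) (YonedaAlgebra.{u, v, w} M) := by
  refine Module.Injective.of_solvable {x | ∃ (i : ℤ) (γ : ShiftedEnd M i), x = ofShiftedEnd M i γ}
    (fun r => ⟨_, ⟨0, _, rfl⟩, _, ⟨1, _, rfl⟩, ?_, eq_ofShiftedEnd_add hA r⟩)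
    (exists_mul_eq_of_relations hA hM)
  refine mem_ringJacobson_of_mul_self_eq_zero fun s => mul_self_eq_zero_of_component_zero hA ?_
  -- The degree 0 part of `s` times a degree 1 element comes from the degree `-1` part of `s`, which
  -- is zero. Hence the product is of pure degree 1 and has square in `Ext² = 0`.
  rw [component_mul_ofShiftedEnd (i := -1) _ _ (by lia), ShiftedEnd.eq_zero_of_neg (by lia)
    (component M (-1) s), ShiftedHom.zero_comp]

theorem injective_yonedaAlgebra_op (hA : ∀ X : A, HasProjectiveDimensionLT X 2)
    (hM : ∀ X : A, FactorsThroughSum (fun Y => Nonempty (Y ≅ M)) (𝟙 X))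
    [IsArtinianRing (YonedaAlgebra.{u, v, w} M)ᵐᵒᵖ]
    [IsNoetherianRing (YonedaAlgebra.{u, v, w} M)ᵐᵒᵖ] :
    Module.Injective (YonedaAlgebra.{u, v, w} M)ᵐᵒᵖ (YonedaAlgebra.{u, v, w} M)ᵐᵒᵖ := by
  refine Module.Injective.of_solvable
    {x | ∃ (i : ℤ) (γ : ShiftedEnd M i), x.unop = ofShiftedEnd M i γ}
    (fun r => ⟨MulOpposite.op _, ⟨0, _, rfl⟩, MulOpposite.op _, ⟨1, _, rfl⟩, ?_,
      MulOpposite.unop_injective (eq_ofShiftedEnd_add hA r.unop)⟩) fun ι _ a b ha hab => ?_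
  · refine mem_ringJacobson_of_mul_self_eq_zero fun s => MulOpposite.unop_injective
      (mul_self_eq_zero_of_component_zero hA ?_)
    rw [MulOpposite.unop_mul, MulOpposite.unop_op,
      component_ofShiftedEnd_mul (j := -1) _ _ (by lia), ShiftedEnd.eq_zero_of_neg (by lia)
      (component M (-1) s.unop), ShiftedHom.comp_zero]
  · obtain ⟨y, hy⟩ := exists_mul_eq_of_relations' hA hM ι (fun j => (a j).unop)
      (fun j => (b j).unop) ha fun z hz => by
        have := hab (fun j => MulOpposite.op (z j)) (MulOpposite.unop_injective (by
          simpa [Finset.unop_sum] using hz))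
        simpa [Finset.unop_sum] using congrArg MulOpposite.unop this
    exact ⟨MulOpposite.op y, fun j => MulOpposite.unop_injective (hy j)⟩

end SelfInjective

/-! ### Finite-dimensionality of the Yoneda algebra -/

section FiniteDimensional

open Abelian

variable (k : Type t) [CommRing k] {A : Type u} [Category.{v} A] [Abelian A] [Linear k A]
  [HasExt.{w} A] (M : A)

theorem yonedaAlgebra_smul_mul_and_mul_smul (c : k) (x y : YonedaAlgebra.{u, v, w} M) :
    c • x * y = c • (x * y) ∧ x * c • y = c • (x * y) := by
  have hs : ∀ (n : ℕ) (α : Ext.{w} M M n), c • DirectSum.of (fun n => Ext.{w} M M n) n α =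
      DirectSum.of (fun n => Ext.{w} M M n) n (c • α) := fun n α =>
    ((DirectSum.lof k ℕ (fun n => Ext.{w} M M n) n).map_smul c α).symm
  induction x using DirectSum.induction_on with
  | zero => simp
  | add x x' hx hx' =>
    exact ⟨by rw [smul_add, add_mul, add_mul, smul_add, hx.1, hx'.1],
      by rw [add_mul, add_mul, smul_add, hx.2, hx'.2]⟩
  | of n α =>
    induction y using DirectSum.induction_on with
    | zero => simp
    | add y y' hy hy' =>
      exact ⟨by rw [mul_add, mul_add, smul_add, hy.1, hy'.1],
        by rw [smul_add, mul_add, mul_add, smul_add, hy.2, hy'.2]⟩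
    | of m β =>
      rw [hs, hs, DirectSum.of_mul_of, DirectSum.of_mul_of, DirectSum.of_mul_of, hs]
      exact ⟨congrArg _ (Ext.smul_comp α β rfl c), congrArg _ (Ext.comp_smul α β rfl c)⟩

/-- The Yoneda algebra of an object of a `k`-linear category is a `k`-algebra. -/
noncomputable abbrev yonedaAlgebraAlgebra : Algebra k (YonedaAlgebra.{u, v, w} M) :=
  Algebra.ofModule (fun c x y => (yonedaAlgebra_smul_mul_and_mul_smul k M c x y).1)
    fun c x y => (yonedaAlgebra_smul_mul_and_mul_smul k M c x y).2

/-- The connecting map from `Hom(S.X₁, Y)` is onto because `Ext¹(S.X₂, Y) = 0`. -/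
theorem finite_ext_one [IsNoetherianRing k] {S : ShortComplex A} (hS : S.ShortExact)
    [Projective S.X₂] (Y : A) [Module.Finite k (S.X₁ ⟶ Y)] :
    Module.Finite k (Ext.{w} S.X₃ Y 1) := by
  have : Module.Finite k (Ext.{w} S.X₁ Y 0) := .equiv (Ext.linearEquiv₀ (R := k)).symm
  refine Module.Finite.of_surjective (hS.extClass.precompOfLinear k Y (add_zero 1)) fun x => ?_
  exact Ext.contravariant_sequence_exact₃ hS Y x (Ext.eq_zero_of_projective _) (add_zero 1)

theorem finite_yonedaAlgebra [HasProjectiveDimensionLT M 2] [Module.Finite k (M ⟶ M)]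
    [Module.Finite k (Ext.{w} M M 1)] : Module.Finite k (YonedaAlgebra.{u, v, w} M) := by
  have : Module.Finite k (Ext.{w} M M 0) := .equiv (Ext.linearEquiv₀ (R := k)).symm
  refine Module.Finite.of_surjective
    ((DirectSum.lof k ℕ (fun n => Ext.{w} M M n) 0).coprod
      (DirectSum.lof k ℕ (fun n => Ext.{w} M M n) 1)) ?_
  rw [← LinearMap.range_eq_top, eq_top_iff]
  rintro x -
  induction x using DirectSum.induction_on with
  | zero => exact zero_mem _
  | add x y hx hy => exact add_mem hx hy
  | of n α =>
    match n, α with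
    | 0, α => exact ⟨(α, 0), by simp [DirectSum.lof_eq_of]⟩
    | 1, α => exact ⟨(0, α), by simp [DirectSum.lof_eq_of]⟩
    | n + 2, α =>
      rw [α.eq_zero_of_hasProjectiveDimensionLT 2 (by lia), map_zero]
      exact zero_mem _

end FiniteDimensional

section FGModuleCat

variable {k : Type u} [Field k] {Λ : Type v} [Ring Λ] [Algebra k Λ] [Module.Finite k Λ]

noncomputable instance : Linear k (FGModuleCat.{v} Λ) :=
  inferInstanceAs (Linear k (ModuleCat.isFG Λ).FullSubcategory)

open scoped ModuleCat in
instance (X Y : FGModuleCat.{v} Λ) : Module.Finite k (X ⟶ Y) := by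
  obtain ⟨n, p, hp⟩ := Module.Finite.exists_fin' Λ X
  have : IsScalarTower k Λ Y := ModuleCat.isScalarTower_of_algebra_moduleCat Y.obj
  have : Module.Finite k Y := .trans Λ Y
  -- A morphism is determined by its values on finitely many generators of `X`.
  let F : (X ⟶ Y) →ₗ[k] (Fin n → Y) :=
    { toFun := fun f j => f.hom.hom (p (Pi.single j 1))
      map_add' := fun _ _ => rfl
      map_smul' := fun _ _ => rfl }
  refine Module.Finite.of_injective F fun f g hfg => ?_
  ext x
  obtain ⟨y, rfl⟩ := hp x
  have : f.hom.hom.comp p = g.hom.hom.comp p := LinearMap.pi_ext' fun j => by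
    ext
    exact congrFun hfg j
  exact LinearMap.congr_fun this y

end FGModuleCat

/-! ### The main theorem -/

theorem isGradedSelfInjective_yonedaGrading {A : Type u} [Category.{v} A] [Abelian A] [HasExt.{w} A]
    (M : A) [IsNoetherianRing (YonedaAlgebra.{u, v, w} M)]
    [IsNoetherianRing (YonedaAlgebra.{u, v, w} M)ᵐᵒᵖ]
    (h : IsSelfInjectiveRing (YonedaAlgebra.{u, v, w} M)) :
    IsGradedSelfInjective (yonedaGrading.{u, v, w} M) := by
  -- The degree projections are built in a derived category, which the statement does not mention,
  -- so one is chosen.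
  let := HasDerivedCategory.standard A
  have := h.1
  have := h.2
  let p (i : ℤ) : (YonedaAlgebra.{u, v, w} M)ᵐᵒᵖ →+ (YonedaAlgebra.{u, v, w} M)ᵐᵒᵖ :=
    AddMonoidHom.mk' (fun x => MulOpposite.op (degreeProj M i x.unop)) fun x y => by simp
  have hp (x : YonedaAlgebra.{u, v, w} M) : MulOpposite.op x ∈ AddSubgroup.closure
      (⋃ i, (opGrading (yonedaGrading M) i : Set (YonedaAlgebra.{u, v, w} M)ᵐᵒᵖ)) := by
    induction closure_yonedaGrading x using AddSubgroup.closure_induction with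
    | mem x hx =>
      obtain ⟨i, hi⟩ := Set.mem_iUnion.1 hx
      exact AddSubgroup.subset_closure (Set.mem_iUnion.2 ⟨i, (mem_opGrading _).2 hi⟩)
    | zero => exact zero_mem _
    | add x y _ _ hx hy => exact add_mem hx hy
    | neg x _ hx => exact neg_mem hx
  exact ⟨.of_isNoetherianRing _, .of_isNoetherianRing _,
    .of_injective _ (degreeProj M) degreeProj_mem (fun i x hx => degreeProj_of_mem hx)
      (fun i j a ha x => degreeProj_mul (add_comm j i) ha x) closure_yonedaGrading,
    .of_injective _ p
      (fun i x => (mem_opGrading _).2 (degreeProj_mem i x.unop))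
      (fun i x hx => MulOpposite.unop_injective (degreeProj_of_mem ((mem_opGrading _).1 hx)))
      (fun i j a ha x => MulOpposite.unop_injective
        (degreeProj_mul' rfl ((mem_opGrading _).1 ha) x.unop)) fun r => hp r.unop⟩

/-- Finite dimension over `k`, obtained from a projective resolution of length one, makes the Yoneda
algebra and its opposite Artinian and Noetherian, as the reduction to maximal ideals requires. -/
theorem IsHereditaryRing.yonedaAlgebra_selfInjective {k : Type u} [Field k] {Λ : Type v} [Ring Λ]
    [Algebra k Λ] [Module.Finite k Λ] [IsNoetherianRing Λ] [HasExt.{w} (FGModuleCat.{v} Λ)]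
    (hΛ : IsHereditaryRing Λ) (M : FGModuleCat.{v} Λ) (hM : IsAdditiveGenerator M) :
    IsGradedSelfInjective (yonedaGrading.{v + 1, v, w} M) ∧
      IsSelfInjectiveRing (YonedaAlgebra.{v + 1, v, w} M) := by
  let := HasDerivedCategory.standard (FGModuleCat.{v} Λ)
  have hA := hΛ.hasProjectiveDimensionLT
  have : HasFiniteBiproducts (FGModuleCat.{v} Λ) := .of_hasFiniteProducts
  have hM' := fun X => (addClosure_iff_factorsThroughSum _ X).1 (hM X)
  have := hA M
  have : Module.Finite k (Abelian.Ext.{w} M M 1) := by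
    obtain ⟨S, hS, hSM, -, hS2⟩ := hΛ.exists_resolution M
    have := finite_ext_one.{v + 1, v, w} k hS M
    rwa [hSM] at this
  have := finite_yonedaAlgebra.{v + 1, v, w} k M
  let := yonedaAlgebraAlgebra.{v + 1, v, w} k M
  have : IsArtinianRing (YonedaAlgebra.{v + 1, v, w} M) := .of_finite k _
  have : IsNoetherianRing (YonedaAlgebra.{v + 1, v, w} M) := .of_finite k _
  have : Module.Finite k (YonedaAlgebra.{v + 1, v, w} M)ᵐᵒᵖ :=
    .equiv (MulOpposite.opLinearEquiv k)
  have : IsArtinianRing (YonedaAlgebra.{v + 1, v, w} M)ᵐᵒᵖ := .of_finite k _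
  have : IsNoetherianRing (YonedaAlgebra.{v + 1, v, w} M)ᵐᵒᵖ := .of_finite k _
  have h : IsSelfInjectiveRing (YonedaAlgebra.{v + 1, v, w} M) :=
    ⟨injective_yonedaAlgebra hA hM', injective_yonedaAlgebra_op hA hM'⟩
  exact ⟨isGradedSelfInjective_yonedaGrading M h, h⟩

theorem proposition5p2 (k : Type u) [Field k] (Λ : Type v) [Ring Λ] [Algebra k Λ]
    [Module.Finite k Λ] :
    haveI : IsNoetherianRing Λ := IsNoetherianRing.of_finite k Λ
    (∀ [HasDerivedCategory.{w} (FGModuleCat.{v} Λ)],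
      (IsSelfInjectiveCategory (YonedaCategory.{v, w} Λ) ↔ IsHereditaryRing Λ) ∧
      (RepresentablesAreInjective (YonedaCategory.{v, w} Λ) → IsHereditaryRing Λ)) ∧
    (∀ [HasExt.{w'} (FGModuleCat.{v} Λ)],
      IsRepresentationFinite Λ → IsHereditaryRing Λ →
      ∀ M : FGModuleCat.{v} Λ, IsAdditiveGenerator M →
        IsGradedSelfInjective (yonedaGrading.{v + 1, v, w'} M) ∧
        IsSelfInjectiveRing (YonedaAlgebra.{v + 1, v, w'} M)) := by
  have : IsNoetherianRing Λ := IsNoetherianRing.of_finite k Λ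
  refine ⟨⟨⟨fun h => isHereditaryRing_of_representablesAreInjective h.injective,
    fun h => h.isSelfInjectiveCategory⟩, isHereditaryRing_of_representablesAreInjective⟩, ?_⟩
  intro _ _ hΛ M hM
  exact hΛ.yonedaAlgebra_selfInjective (k := k) M hM
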